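/- Let $\mathbf H$ be the Hilbert space of all sequences $\psi=(\psi_0,\psi_1,\psi_2,\dots)$ with $\psi_n\in L^2(\mathbb R^{3n+3};\mathbb C)$ and $\|\psi\|^2=\sum_{n\ge 0}\|\psi_n\|^2<\infty$ (no permutation symmetry is imposed); the arguments of $\psi_n$ are written $(\mathbf k_1,\dots,\mathbf k_n;\mathbf p)$ with $\mathbf k_i,\mathbf p\in\mathbb R^3$. For a sequence of functions $\psi$ put $A\psi=A^+\psi+A^-\psi$, where $(A^+\psi)_0=0$, $(A^+\psi)_n=A^+_{n-1}\psi_{n-1}$ and $(A^-\psi)_{n-1}=A^-_n\psi_n$ for $n\ge 1$, with $$A^+_{n-1}\psi_{n-1}(\mathbf k_1,\dots,\mathbf k_n;\mathbf p)=\frac1{\sqrt n}\sum_{i=1}^n\frac1{\sqrt{|\mathbf k_i|}}\,\psi_{n-1}(\mathbf k_1,\dots,\mathbf k_{i-1},\mathbf k_{i+1},\dots,\mathbf k_n;\mathbf p+\mathbf k_i),$$ $$A^-_n\psi_n(\mathbf k_1,\dots,\mathbf k_{n-1};\mathbf p)=\frac1{\sqrt n}\sum_{i=1}^n\int_{\mathbb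 R^3}\frac1{\sqrt{|\mathbf k|}}\,\psi_n(\mathbf k_1,\dots,\mathbf k_{i-1},\mathbf k,\mathbf k_i,\dots,\mathbf k_{n-1};\mathbf p-\mathbf k)\,d\mathbf k.$$ For $n\ge 2$ let $p_n(\mathbf k_1,\dots,\mathbf k_{n-1})=e^n\prod_{i=1}^{n-1}(|\mathbf k_i|^2+1)^2$ and $$E_n=\{(\mathbf k_1,\dots,\mathbf k_n)\in\mathbb R^{3n}: e^{p_n(\mathbf k_1,\dots,\mathbf k_{n-1})/2}<|\mathbf k_n|<e^{p_n(\mathbf k_1,\dots,\mathbf k_{n-1})}\}.$$ For $X\subset\mathbb R^{3N}=(\mathbb R^3)^N$ let $\mathcal S X$ be the set of all $N$-tuples of vectors in $\mathbb R^3$ that have a permutation belonging to $X$. Put $F_1=\emptyset$ and $F_n=\mathcal S\big((F_{n-1}^{\complement}\times\mathbb R^3)\cap E_n\big)$ for $n\ge2$. Let $1_T$ be the operator $(1_T\psi)_0=0$, $(1_T\psi)_n=1_{F_n\times\mathbb R^3}\psi_n$ for $n\ge1$, and let $1_{T^\complement}\psi=\psi-1_T\psi$. Let $$V=\{\psi\in\mathbf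 H:\ \|1_T A^+1_{T^\complement}\psi\|<\infty\},\qquad U=\{\psi\in\mathbf H:\ A\psi\text{ is defined and }\|A\psi\|<\infty\},$$ where $A\psi$ is defined if, for almost every $(\mathbf k_1,\dots,\mathbf k_{n-1};\mathbf p)$ and for all $n\ge 1$, the integrals in $A^-_n\psi_n$ converge absolutely. Let $H_{\mathrm I}$ be the linear operator on $\mathbf H$ with domain $\mathrm{Dom}(H_{\mathrm I})=V\cap U$ and $H_{\mathrm I}\psi=A\psi$. Then $\mathrm{Dom}(H_{\mathrm I})$ is dense in $\mathbf H$, and $H_{\mathrm I}$ is self-adjoint (i.e. $H_{\mathrm I}^*=H_{\mathrm I}$, including equality of the domains). -/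

import Mathlib

open MeasureTheory
open scoped ENNReal

noncomputable section

namespace SimplifiedDirac

/-! ### The Hilbert space -/

/-- Three-dimensional Euclidean space (of momenta). -/
abbrev R3 : Type := EuclideanSpace ℝ (Fin 3)

/-- The points `(k₁, …, kₙ; p)` of `ℝ^{3n+3}`; it carries Lebesgue measure (`volume`). -/
abbrev Config (n : ℕ) : Type := (Fin n → R3) × R3

/-- The Hilbert space of sequences `(ψ₀, ψ₁, …)` with `ψₙ ∈ L²(ℝ^{3n+3})` and
`∑ ‖ψₙ‖² < ∞`; no permutation symmetry is imposed. -/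
abbrev Fock : Type := lp (fun n : ℕ => Lp ℂ 2 (volume : Measure (Config n))) 2

/-- Sequences of complex functions, `fₙ` being a function on `ℝ^{3n+3}`. -/
abbrev Seq : Type := (n : ℕ) → Config n → ℂ

/-- The sequence of functions that a vector of the Hilbert space consists of. -/
def rep (ψ : Fock) : Seq := fun n => (ψ n : Config n → ℂ)

/-- `‖f‖ < ∞`: all `fₙ` are square-integrable and `∑ ‖fₙ‖² < ∞`. -/
def FiniteNorm (f : Seq) : Prop :=
  (∀ n, MemLp (f n) 2 volume) ∧ Summable fun n => (eLpNorm (f n) 2 volume).toReal ^ 2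

/-- The vector of the Hilbert space given by a sequence of finite norm. -/
def toFock (f : Seq) (h : FiniteNorm f) : Fock :=
  ⟨fun n => (h.1 n).toLp (f n), by
    refine memℓp_gen ?_
    simpa [Lp.norm_toLp] using h.2⟩

/-! ### The formal operator `A = A⁺ + A⁻` -/

/-- `A⁺ₙ f (k₁, …, kₙ₊₁; p)
  = (n+1)^{-1/2} ∑ᵢ |kᵢ|^{-1/2} f (k₁, …, k̂ᵢ, …, kₙ₊₁; p + kᵢ)`. -/
def creation (n : ℕ) (f : Config n → ℂ) : Config (n + 1) → ℂ := fun x =>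
  (((Real.sqrt (n + 1))⁻¹ : ℝ) : ℂ) * ∑ i : Fin (n + 1),
    (((Real.sqrt ‖x.1 i‖)⁻¹ : ℝ) : ℂ) * f (fun j => x.1 (i.succAbove j), x.2 + x.1 i)

/-- The `i`-th integrand in `A⁻`, as a function of the integration variable `k`:
`|k|^{-1/2} f (k₁, …, kᵢ₋₁, k, kᵢ, …, kₙ; p - k)`. -/
def integrand (n : ℕ) (f : Config (n + 1) → ℂ) (i : Fin (n + 1)) (x : Config n) (k : R3) : ℂ :=
  (((Real.sqrt ‖k‖)⁻¹ : ℝ) : ℂ) * f (i.insertNth (α := fun _ => R3) k x.1, x.2 - k)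

/-- `A⁻ₙ₊₁ f (k₁, …, kₙ; p)
  = (n+1)^{-1/2} ∑ᵢ ∫ |k|^{-1/2} f (k₁, …, kᵢ₋₁, k, kᵢ, …, kₙ; p - k) dk`. -/
def annihilation (n : ℕ) (f : Config (n + 1) → ℂ) : Config n → ℂ := fun x =>
  (((Real.sqrt (n + 1))⁻¹ : ℝ) : ℂ) * ∑ i : Fin (n + 1), ∫ k : R3, integrand n f i x k

/-- `A⁺ f = (0, A⁺₀ f₀, A⁺₁ f₁, …)`. -/
def Aplus (f : Seq) : Seq
  | 0 => 0
  | n + 1 => creation n (f n)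

/-- `A⁻ f = (A⁻₁ f₁, A⁻₂ f₂, …)`. -/
def Aminus (f : Seq) : Seq := fun n => annihilation n (f (n + 1))

/-- `A f = A⁺ f + A⁻ f`. -/
def A (f : Seq) : Seq := Aplus f + Aminus f

/-- All integrals in `A⁻ f` converge absolutely, almost everywhere. -/
def AbsConv (f : Seq) : Prop :=
  ∀ (n : ℕ) (i : Fin (n + 1)), ∀ᵐ x : Config n, Integrable (integrand n (f (n + 1)) i x)

/-! ### The sets `Fₙ` and the domain -/

/-- `pfun n` is the function `pₙ₊₁ (k₁, …, kₙ) = e^{n+1} ∏ᵢ (kᵢ² + 1)²`. -/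
def pfun (n : ℕ) (k : Fin n → R3) : ℝ :=
  Real.exp (n + 1) * ∏ i, (‖k i‖ ^ 2 + 1) ^ 2

/-- `Eset n` is the set `Eₙ₊₁` of all `(k₁, …, kₙ₊₁)` with
`e^{pₙ₊₁(k₁, …, kₙ)/2} < |kₙ₊₁| < e^{pₙ₊₁(k₁, …, kₙ)}`. -/
def Eset (n : ℕ) : Set (Fin (n + 1) → R3) :=
  {k | Real.exp (pfun n (fun j => k j.castSucc) / 2) < ‖k (Fin.last n)‖ ∧
    ‖k (Fin.last n)‖ < Real.exp (pfun n (fun j => k j.castSucc))}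

/-- The set of all tuples that have a permutation in `X`. -/
def symmetrize {N : ℕ} (X : Set (Fin N → R3)) : Set (Fin N → R3) :=
  {k | ∃ σ : Equiv.Perm (Fin N), k ∘ σ ∈ X}

/-- The sets `Fₙ`: `F₁ = ∅` and `Fₙ = 𝒮 ((Fₙ₋₁ᶜ × ℝ³) ∩ Eₙ)` for `n ≥ 2`
(and `F₀ = ∅`, so that the sequence `T` starts with the empty set). -/
def F : (n : ℕ) → Set (Fin n → R3)
  | 0 => ∅
  | 1 => ∅
  | n + 2 => symmetrize ({k | (fun j : Fin (n + 1) => k j.castSucc) ∈ (F (n + 1))ᶜ} ∩ Eset (n + 1))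

/-- Multiplication by the indicator functions of `T = (Fₙ × ℝ³)ₙ`. -/
def oneT (f : Seq) : Seq := fun n => Set.indicator (F n ×ˢ Set.univ) (f n)

/-- Multiplication by the indicator functions of `Tᶜ = (Fₙᶜ × ℝ³)ₙ`. -/
def oneTc (f : Seq) : Seq := fun n => Set.indicator ((F n)ᶜ ×ˢ Set.univ) (f n)

/-- `V`: the vectors `ψ` with `‖1_T A⁺ 1_{Tᶜ} ψ‖ < ∞`. -/
def V : Set Fock := {ψ | FiniteNorm (oneT (Aplus (oneTc (rep ψ))))}

/-- `U`: the vectors `ψ` for which `A ψ` is defined (by absolutely convergent integrals, almost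
everywhere) and `‖A ψ‖ < ∞`. -/
def U : Set Fock := {ψ | AbsConv (rep ψ) ∧ FiniteNorm (A (rep ψ))}

/-! ### Linearity -/

/-- Componentwise equality almost everywhere. -/
def SeqEq (f g : Seq) : Prop := ∀ n, f n =ᵐ[volume] g n

theorem FiniteNorm.congr {f g : Seq} (h : SeqEq f g) (hf : FiniteNorm f) : FiniteNorm g := by
  refine ⟨fun n => (memLp_congr_ae (h n)).1 (hf.1 n), ?_⟩
  have : (fun n => (eLpNorm (g n) 2 volume).toReal ^ 2)
      = fun n => (eLpNorm (f n) 2 volume).toReal ^ 2 := by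
    funext n
    rw [eLpNorm_congr_ae (h n)]
  rw [this]
  exact hf.2

theorem FiniteNorm.add {f g : Seq} (hf : FiniteNorm f) (hg : FiniteNorm g) :
    FiniteNorm (f + g) := by
  refine ⟨fun n => (hf.1 n).add (hg.1 n), ?_⟩
  refine Summable.of_nonneg_of_le (fun n => by positivity) (fun n => ?_)
    ((hf.2.mul_left 2).add (hg.2.mul_left 2))
  have h1 : (eLpNorm ((f + g) n) 2 volume).toReal
      ≤ (eLpNorm (f n) 2 volume).toReal + (eLpNorm (g n) 2 volume).toReal := by
    rw [← ENNReal.toReal_add (hf.1 n).eLpNorm_ne_top (hg.1 n).eLpNorm_ne_top]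
    exact ENNReal.toReal_mono
      (ENNReal.add_ne_top.2 ⟨(hf.1 n).eLpNorm_ne_top, (hg.1 n).eLpNorm_ne_top⟩)
      (eLpNorm_add_le (hf.1 n).1 (hg.1 n).1 (by norm_num))
  have h0 : 0 ≤ (eLpNorm ((f + g) n) 2 volume).toReal := ENNReal.toReal_nonneg
  nlinarith [sq_nonneg ((eLpNorm (f n) 2 volume).toReal - (eLpNorm (g n) 2 volume).toReal)]

theorem FiniteNorm.smul {f : Seq} (c : ℂ) (hf : FiniteNorm f) : FiniteNorm (c • f) := by
  refine ⟨fun n => (hf.1 n).const_smul c, ?_⟩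
  have : (fun n => (eLpNorm ((c • f) n) 2 volume).toReal ^ 2)
      = fun n => ‖c‖ ^ 2 * (eLpNorm (f n) 2 volume).toReal ^ 2 := by
    funext n
    rw [Pi.smul_apply, eLpNorm_const_smul, ENNReal.toReal_mul, mul_pow]
    simp
  rw [this]
  exact hf.2.mul_left _

theorem FiniteNorm.zero : FiniteNorm (0 : Seq) := by
  refine ⟨fun n => MemLp.zero, ?_⟩
  simp

theorem toFock_congr {f g : Seq} (h : SeqEq f g) (hf : FiniteNorm f) (hg : FiniteNorm g) :
    toFock f hf = toFock g hg := by
  apply Subtype.ext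
  funext n
  exact MemLp.toLp_eq_toLp_iff (hf.1 n) (hg.1 n) |>.2 (h n)

theorem rep_add (ψ φ : Fock) : SeqEq (rep (ψ + φ)) (rep ψ + rep φ) := fun n =>
  Lp.coeFn_add (ψ n) (φ n)

theorem rep_smul (c : ℂ) (ψ : Fock) : SeqEq (rep (c • ψ)) (c • rep ψ) := fun n =>
  Lp.coeFn_smul c (ψ n)

theorem rep_zero : SeqEq (rep 0) 0 := fun n => Lp.coeFn_zero ℂ 2 (volume : Measure (Config n))

/-- Removing the `i`-th photon and giving its momentum to the fermion. -/
theorem quasiMeasurePreserving_remove (n : ℕ) (i : Fin (n + 1)) :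
    Measure.QuasiMeasurePreserving
      (fun x : Config (n + 1) => ((fun j => x.1 (i.succAbove j), x.2 + x.1 i) : Config n))
      volume volume := by
  have h1 : MeasurePreserving
      (Prod.map (MeasurableEquiv.piFinSuccAbove (fun _ : Fin (n + 1) => R3) i) (id : R3 → R3))
      (volume : Measure (Config (n + 1))) volume :=
    (volume_preserving_piFinSuccAbove (fun _ : Fin (n + 1) => R3) i).prod (MeasurePreserving.id _)
  have h2 : MeasurePreserving
      (fun y : (R3 × (Fin n → R3)) × R3 => (y.1, y.2 + y.1.1))
      ((volume : Measure (R3 × (Fin n → R3))).prod (volume : Measure R3))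
      ((volume : Measure (R3 × (Fin n → R3))).prod (volume : Measure R3)) :=
    (MeasurePreserving.id (volume : Measure (R3 × (Fin n → R3)))).skew_product
      (g := fun y p => p + y.1) (by fun_prop)
      (Filter.Eventually.of_forall fun y => (measurePreserving_add_right volume y.1).map_eq)
  have h3 : Measure.QuasiMeasurePreserving
      (Prod.map Prod.snd id : (R3 × (Fin n → R3)) × R3 → Config n)
      ((volume : Measure (R3 × (Fin n → R3))).prod (volume : Measure R3)) volume :=
    QuasiMeasurePreserving.prodMap Measure.quasiMeasurePreserving_snd
      (Measure.QuasiMeasurePreserving.id _)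
  exact h3.comp (h2.quasiMeasurePreserving.comp h1.quasiMeasurePreserving)

/-- Inserting a photon of momentum `k`, taken from the fermion, at the `i`-th place. -/
theorem measurePreserving_insert (n : ℕ) (i : Fin (n + 1)) :
    MeasurePreserving
      (fun y : Config n × R3 =>
        ((i.insertNth (α := fun _ => R3) y.2 y.1.1, y.1.2 - y.2) : Config (n + 1)))
      (volume.prod volume) volume := by
  have h0 : MeasurePreserving (Prod.swap : Config n × R3 → R3 × Config n)
      (volume.prod volume) (volume.prod volume) := Measure.measurePreserving_swap
  have h1 : MeasurePreserving
      (fun y : R3 × Config n => (y.1, (y.2.1, y.2.2 - y.1)))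
      ((volume : Measure R3).prod (volume : Measure (Config n)))
      ((volume : Measure R3).prod (volume : Measure (Config n))) :=
    (MeasurePreserving.id (volume : Measure R3)).skew_product
      (g := fun (k : R3) (x : Config n) => ((x.1, x.2 - k) : Config n)) (by fun_prop)
      (Filter.Eventually.of_forall fun k =>
        ((MeasurePreserving.id (volume : Measure (Fin n → R3))).prod
          (measurePreserving_sub_right (volume : Measure R3) k)).map_eq)
  have h2 : MeasurePreserving
      (MeasurableEquiv.prodAssoc.symm : R3 × Config n → (R3 × (Fin n → R3)) × R3)
      (volume.prod volume) (volume.prod volume) :=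
    (volume_preserving_prodAssoc (α₁ := R3) (β₁ := Fin n → R3) (γ₁ := R3)).symm
  have h3 : MeasurePreserving
      (Prod.map (MeasurableEquiv.piFinSuccAbove (fun _ : Fin (n + 1) => R3) i).symm
        (id : R3 → R3))
      ((volume : Measure (R3 × (Fin n → R3))).prod (volume : Measure R3))
      (volume : Measure (Config (n + 1))) :=
    (volume_preserving_piFinSuccAbove (fun _ : Fin (n + 1) => R3) i).symm.prod
      (MeasurePreserving.id _)
  exact h3.comp (h2.comp (h1.comp h0))

theorem creation_congr {n : ℕ} {f g : Config n → ℂ} (h : f =ᵐ[volume] g) :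
    creation n f =ᵐ[volume] creation n g := by
  have : ∀ᵐ x : Config (n + 1), ∀ i : Fin (n + 1),
      f (fun j => x.1 (i.succAbove j), x.2 + x.1 i)
        = g (fun j => x.1 (i.succAbove j), x.2 + x.1 i) :=
    ae_all_iff.2 fun i => (quasiMeasurePreserving_remove n i).ae h
  filter_upwards [this] with x hx
  simp only [creation, hx]

theorem integrand_congr {n : ℕ} {f g : Config (n + 1) → ℂ} (h : f =ᵐ[volume] g)
    (i : Fin (n + 1)) :
    ∀ᵐ x : Config n, integrand n f i x =ᵐ[volume] integrand n g i x := by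
  have h1 := (measurePreserving_insert n i).quasiMeasurePreserving.ae h
  filter_upwards [Measure.ae_ae_of_ae_prod h1] with x hx
  filter_upwards [hx] with k hk
  simp only [integrand, hk]

theorem annihilation_congr {n : ℕ} {f g : Config (n + 1) → ℂ} (h : f =ᵐ[volume] g) :
    annihilation n f =ᵐ[volume] annihilation n g := by
  filter_upwards [ae_all_iff.2 fun i => integrand_congr h i] with x hx
  simp only [annihilation]
  congr 1
  exact Finset.sum_congr rfl fun i _ => integral_congr_ae (hx i)

theorem AbsConv.congr {f g : Seq} (h : SeqEq f g) (hf : AbsConv f) : AbsConv g := by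
  intro n i
  filter_upwards [hf n i, integrand_congr (h (n + 1)) i] with x h1 h2
  exact h1.congr h2

theorem Aplus_congr {f g : Seq} (h : SeqEq f g) : SeqEq (Aplus f) (Aplus g)
  | 0 => Filter.EventuallyEq.rfl
  | n + 1 => creation_congr (h n)

theorem A_congr {f g : Seq} (h : SeqEq f g) : SeqEq (A f) (A g) := fun n =>
  (Aplus_congr h n).add (annihilation_congr (h (n + 1)))

theorem oneT_congr {f g : Seq} (h : SeqEq f g) : SeqEq (oneT f) (oneT g) := fun n => by
  filter_upwards [h n] with x hx
  simp only [oneT, Set.indicator, hx]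

theorem oneTc_congr {f g : Seq} (h : SeqEq f g) : SeqEq (oneTc f) (oneTc g) := fun n => by
  filter_upwards [h n] with x hx
  simp only [oneTc, Set.indicator, hx]

theorem Aplus_add (f g : Seq) : Aplus (f + g) = Aplus f + Aplus g := by
  funext n x
  cases n with
  | zero => simp [Aplus]
  | succ n => simp [Aplus, creation, mul_add, Finset.sum_add_distrib]

theorem Aplus_smul (c : ℂ) (f : Seq) : Aplus (c • f) = c • Aplus f := by
  funext n x
  cases n with
  | zero => simp [Aplus]
  | succ n => simp [Aplus, creation, mul_left_comm _ c, Finset.mul_sum]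

theorem oneT_add (f g : Seq) : oneT (f + g) = oneT f + oneT g := by
  funext n
  exact Set.indicator_add _ _ _

theorem oneTc_add (f g : Seq) : oneTc (f + g) = oneTc f + oneTc g := by
  funext n
  exact Set.indicator_add _ _ _

theorem oneT_smul (c : ℂ) (f : Seq) : oneT (c • f) = c • oneT f := by
  funext n
  exact Set.indicator_const_smul _ c _

theorem oneTc_smul (c : ℂ) (f : Seq) : oneTc (c • f) = c • oneTc f := by
  funext n
  exact Set.indicator_const_smul _ c _

theorem integrand_add {n : ℕ} (f g : Config (n + 1) → ℂ) (i : Fin (n + 1)) (x : Config n) :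
    integrand n (f + g) i x = integrand n f i x + integrand n g i x := by
  funext k
  simp [integrand, mul_add]

theorem integrand_smul {n : ℕ} (c : ℂ) (f : Config (n + 1) → ℂ) (i : Fin (n + 1))
    (x : Config n) : integrand n (c • f) i x = c • integrand n f i x := by
  funext k
  simp [integrand, mul_left_comm _ c]

theorem AbsConv.add {f g : Seq} (hf : AbsConv f) (hg : AbsConv g) : AbsConv (f + g) := by
  intro n i
  filter_upwards [hf n i, hg n i] with x h1 h2
  rw [Pi.add_apply, integrand_add]
  exact h1.add h2

theorem AbsConv.smul {f : Seq} (c : ℂ) (hf : AbsConv f) : AbsConv (c • f) := by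
  intro n i
  filter_upwards [hf n i] with x h1
  rw [Pi.smul_apply, integrand_smul]
  exact h1.smul c

theorem Aminus_add {f g : Seq} (hf : AbsConv f) (hg : AbsConv g) :
    SeqEq (Aminus (f + g)) (Aminus f + Aminus g) := by
  intro n
  filter_upwards [ae_all_iff.2 (hf n), ae_all_iff.2 (hg n)] with x h1 h2
  simp only [Aminus, annihilation, Pi.add_apply, integrand_add]
  rw [← mul_add, ← Finset.sum_add_distrib]
  congr 1
  exact Finset.sum_congr rfl fun i _ => integral_add (h1 i) (h2 i)

theorem Aminus_smul (c : ℂ) (f : Seq) : Aminus (c • f) = c • Aminus f := by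
  funext n x
  have h : ∀ i : Fin (n + 1), ∫ k : R3, (c • integrand n (f (n + 1)) i x) k
      = c * ∫ k : R3, integrand n (f (n + 1)) i x k := fun i =>
    integral_const_mul c _
  change _ * ∑ i, ∫ k : R3, integrand n (c • f (n + 1)) i x k
    = c * (_ * ∑ i, ∫ k : R3, integrand n (f (n + 1)) i x k)
  simp only [integrand_smul, h, ← Finset.mul_sum]
  exact mul_left_comm _ c _

theorem A_add {f g : Seq} (hf : AbsConv f) (hg : AbsConv g) : SeqEq (A (f + g)) (A f + A g) := by
  intro n
  filter_upwards [Aminus_add hf hg n] with x hx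
  simp only [A, Aplus_add, Pi.add_apply] at hx ⊢
  rw [hx]
  ring

theorem A_smul (c : ℂ) (f : Seq) : A (c • f) = c • A f := by
  rw [A, A, Aplus_smul, Aminus_smul, smul_add]

theorem SeqEq.symm {f g : Seq} (h : SeqEq f g) : SeqEq g f := fun n => (h n).symm

theorem SeqEq.trans {f g k : Seq} (h : SeqEq f g) (h' : SeqEq g k) : SeqEq f k :=
  fun n => (h n).trans (h' n)

theorem cut_congr {f g : Seq} (h : SeqEq f g) :
    SeqEq (oneT (Aplus (oneTc f))) (oneT (Aplus (oneTc g))) :=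
  oneT_congr (Aplus_congr (oneTc_congr h))

/-! ### The operator -/

/-- The domain `V ∩ U`. -/
def domainHI : Submodule ℂ Fock where
  carrier := V ∩ U
  add_mem' := by
    rintro ψ φ ⟨h1, h2, h3⟩ ⟨g1, g2, g3⟩
    refine ⟨?_, (h2.add g2).congr (rep_add ψ φ).symm, ?_⟩
    · refine FiniteNorm.congr (cut_congr (rep_add ψ φ).symm) ?_
      rw [oneTc_add, Aplus_add, oneT_add]
      exact FiniteNorm.add h1 g1
    · exact FiniteNorm.congr ((A_add h2 g2).symm.trans (A_congr (rep_add ψ φ).symm)) (h3.add g3)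
  zero_mem' := by
    have hz : SeqEq ((0 : ℂ) • (0 : Seq)) (rep 0) := by
      rw [smul_zero]
      exact rep_zero.symm
    refine ⟨?_, ?_, ?_⟩
    · refine FiniteNorm.congr (cut_congr hz) ?_
      rw [oneTc_smul, Aplus_smul, oneT_smul, zero_smul]
      exact FiniteNorm.zero
    · refine AbsConv.congr rep_zero.symm fun n i => ?_
      refine Filter.Eventually.of_forall fun x => ?_
      have : integrand n ((0 : Seq) (n + 1)) i x = fun _ => 0 := by
        funext k
        simp [integrand]
      rw [this]
      exact integrable_zero _ _ _
    · refine FiniteNorm.congr (A_congr hz) ?_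
      rw [A_smul, zero_smul]
      exact FiniteNorm.zero
  smul_mem' := by
    rintro c ψ ⟨h1, h2, h3⟩
    refine ⟨?_, (h2.smul c).congr (rep_smul c ψ).symm, ?_⟩
    · refine FiniteNorm.congr (cut_congr (rep_smul c ψ).symm) ?_
      rw [oneTc_smul, Aplus_smul, oneT_smul]
      exact FiniteNorm.smul c h1
    · refine FiniteNorm.congr (A_congr (rep_smul c ψ).symm) ?_
      rw [A_smul]
      exact h3.smul c

/-- The operator `H_I`, with domain `V ∩ U`, that sends `ψ` to the vector `A ψ`. -/
def HI : Fock →ₗ.[ℂ] Fock where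
  domain := domainHI
  toFun :=
    { toFun := fun ψ => toFock (A (rep ψ.1)) ψ.2.2.2
      map_add' := by
        intro ψ φ
        exact toFock_congr ((A_congr (rep_add ψ.1 φ.1)).trans (A_add ψ.2.2.1 φ.2.2.1)) _
          (FiniteNorm.add ψ.2.2.2 φ.2.2.2)
      map_smul' := by
        intro c ψ
        have h := A_congr (rep_smul c ψ.1)
        rw [A_smul] at h
        exact toFock_congr h _ (FiniteNorm.smul c ψ.2.2.2) }

end SimplifiedDirac

end

/-! The difficulty is that `A` creates photons with the form factor `|k|^{-1/2}`, which is not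
square integrable at infinity. The set `T` repairs this. A configuration lies in `F` exactly when
one photon, the large one, lies in the shell `e^{p/2} < |k| < e^p` fixed by the others, and the
others lie outside `F`. Removing any photon from a configuration in `F` leads out of `F`
(`Big.drop_notMem`), so `1_T A 1_T = 0`, and `A` is a block matrix with a vanishing corner.

The shell integral of `1/|k|` is comparable to `e^{2p}`. Creating the large photon therefore
multiplies norms by about `e^p` (`exists_lower_bound`). Hence a vector `ψ` in `V` must satisfy
`1_{Tᶜ} ψ = e^{-p} x` with `x` in the Hilbert space (`exists_decomp_of_mem_V`). Conversely, the
weight `e^{-p}` makes every block that involves `Tᶜ` bounded: with `P = 1_T`, `R = e^{-p} 1_{Tᶜ}`,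
`G = P A R` and `N = R A R`, the equation `A ψ = η` becomes `P η = G x` and `R η = G† ψ + N x`
(`opP_HI`, `mem_domain_HI`).

In this form symmetry is immediate, and for `c = ±i` the equation `(A - c) ψ = η` reduces, by
elimination of `P ψ`, to `(G†G + R² + cN) x = c R η + G† P η`. Since `cN` is skew-adjoint, the real
part of the form of the left side is `‖G x‖² + ‖R x‖²`, and Lax–Milgram applies once `‖x‖ ≤ C (‖G x‖
+ ‖R x‖)` on the range of `1 - P`. That estimate is `exists_norm_le`: the large-photon part of `G`
is bounded below up to `R`, and the rest of `G` factors through `e^{-p/2}`, which is controlled by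
interpolation. A symmetric operator with both `A - i` and `A + i` onto is densely defined and
self-adjoint. -/

noncomputable section

namespace SimplifiedDirac

/-! ### Self-adjointness of abstract operators -/

section Abstract

variable {H : Type*} [NormedAddCommGroup H] [InnerProductSpace ℂ H]

/-- A symmetric operator `T` such that `T - i` and `T + i` are onto is densely defined. -/
theorem dense_domain_of_surjective (T : H →ₗ.[ℂ] H) [CompleteSpace H]
    (hsym : ∀ x y : T.domain, inner ℂ (T x) (y : H) = inner ℂ (x : H) (T y))
    (hm : ∀ η : H, ∃ x : T.domain, T x - Complex.I • (x : H) = η)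
    (hp : ∀ η : H, ∃ x : T.domain, T x + Complex.I • (x : H) = η) :
    Dense (T.domain : Set H) := by
  rw [Submodule.dense_iff_topologicalClosure_eq_top, Submodule.topologicalClosure_eq_top_iff,
    Submodule.eq_bot_iff]
  intro χ hχ
  -- With `χ` orthogonal to the domain, `χ = (T + i) x` and `x = (T - i) y`, symmetry gives `⟨x, x⟩
  -- = ⟨x, (T - i) y⟩ = ⟨χ, y⟩ = 0`. No density is needed.
  obtain ⟨x, hx⟩ := hp χ
  obtain ⟨y, hy⟩ := hm x
  have h1 : inner ℂ χ (y : H) = 0 := Submodule.inner_left_of_mem_orthogonal y.2 hχ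
  have h2 : inner ℂ (x : H) (x : H) = 0 := by
    nth_rewrite 2 [← hy]
    rw [← hx] at h1
    rw [inner_add_left, inner_smul_left, Complex.conj_I, hsym] at h1
    rw [inner_sub_right, inner_smul_right]
    linear_combination h1
  have h3 : x = 0 := by
    ext
    simpa using h2
  rw [← hx, h3]
  simp

/-- A symmetric operator `T` such that `T - i` and `T + i` are onto is self-adjoint. -/
theorem isSelfAdjoint_of_surjective (T : H →ₗ.[ℂ] H) [CompleteSpace H]
    (hsym : ∀ x y : T.domain, inner ℂ (T x) (y : H) = inner ℂ (x : H) (T y))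
    (hm : ∀ η : H, ∃ x : T.domain, T x - Complex.I • (x : H) = η)
    (hp : ∀ η : H, ∃ x : T.domain, T x + Complex.I • (x : H) = η) :
    IsSelfAdjoint T := by
  have hd := dense_domain_of_surjective T hsym hm hp
  have hfa : T.IsFormalAdjoint T := fun x y => hsym x y
  have hle : T ≤ T.adjoint := hfa.le_adjoint hd
  rw [LinearPMap.isSelfAdjoint_def]
  refine (LinearPMap.eq_of_le_of_domain_eq hle (le_antisymm hle.1 fun χ hχ => ?_)).symm
  -- With `(T + i) ψ = (T* + i) χ`, the difference `χ - ψ` lies in the kernel of `T* + i`, which is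
  -- orthogonal to the range of `T - i`, that is, to everything.
  obtain ⟨ψ, hψ⟩ := hp (T.adjoint ⟨χ, hχ⟩ + Complex.I • χ)
  suffices h : χ - ψ = 0 by
    rw [sub_eq_zero] at h
    rw [h]
    exact ψ.2
  obtain ⟨y, hy⟩ := hm (χ - ψ)
  have h1 : inner ℂ (T.adjoint ⟨χ, hχ⟩) (y : H) = inner ℂ χ (T y) :=
    LinearPMap.adjoint_isFormalAdjoint hd ⟨χ, hχ⟩ y
  have h2 : T.adjoint ⟨χ, hχ⟩ = T ψ + Complex.I • (ψ : H) - Complex.I • χ := by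
    rw [hψ]; simp
  rw [← inner_self_eq_zero (𝕜 := ℂ)]
  nth_rewrite 2 [← hy]
  rw [h2, inner_sub_left, inner_add_left, inner_smul_left, inner_smul_left, hsym,
    Complex.conj_I] at h1
  rw [inner_sub_right, inner_smul_right, inner_sub_left, inner_sub_left]
  linear_combination -h1

variable [CompleteSpace H]

/-- The equation `(G†G + R² + isN) x = b` is solvable, by coercivity of `G†G + R²`. -/
theorem exists_resolvent_solution {P R G N : H →L[ℂ] H}
    (hP : ∀ x y, inner ℂ (P x) y = inner ℂ x (P y))
    (hPP : ∀ x, P (P x) = P x) (hR : ∀ x y, inner ℂ (R x) y = inner ℂ x (R y))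
    (hPR : ∀ x, P (R x) = 0) (hN : ∀ x y, inner ℂ (N x) y = inner ℂ x (N y))
    (hPN : ∀ x, P (N x) = 0) (hGP : ∀ x, G (P x) = 0) {C : ℝ}
    (hC : ∀ x, P x = 0 → ‖x‖ ≤ C * (‖G x‖ + ‖R x‖)) (s : ℝ) (b : H) (hb : P b = 0) :
    ∃ x, P x = 0 ∧
      G.adjoint (G x) + R (R x) + ((s : ℂ) * Complex.I) • N x = b := by
  have hRP : ∀ x, R (P x) = 0 := fun x => by
    rw [← inner_self_eq_zero (𝕜 := ℂ), hR, hP, hPR, inner_zero_right]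
  have hPG : ∀ x, P (G.adjoint x) = 0 := fun x => by
    rw [← inner_self_eq_zero (𝕜 := ℂ), hP, ContinuousLinearMap.adjoint_inner_left, hPP, hGP,
      inner_zero_right]
  -- The summand `P` makes the form coercive on all of `H`, so that invertibility can be used
  -- without passing to the subspace `ker P`.
  let E : H →L[ℂ] H := G.adjoint ∘L G + R ∘L R + P + ((s : ℂ) * Complex.I) • N
  have hE : ∀ x, E x = G.adjoint (G x) + R (R x) + P x + ((s : ℂ) * Complex.I) • N x :=
    fun x => rfl
  have hre : ∀ x, (inner ℂ (E x) x).re = ‖G x‖ ^ 2 + ‖R x‖ ^ 2 + ‖P x‖ ^ 2 := fun x => by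
    have hNr : (inner ℂ (N x) x).im = 0 := by
      have := hN x x
      rw [← inner_conj_symm x (N x)] at this
      exact Complex.conj_eq_iff_im.1 this.symm
    rw [hE, inner_add_left, inner_add_left, inner_add_left, inner_smul_left,
      ContinuousLinearMap.adjoint_inner_left, hR, ← hPP x, hP, hPP]
    simp only [Complex.add_re]
    have e1 : ∀ v : H, (inner ℂ v v).re = ‖v‖ ^ 2 := fun v =>
      (norm_sq_eq_re_inner (𝕜 := ℂ) v).symm
    rw [e1, e1, e1]
    simp [hNr]
  -- The constant comes from squaring twice: `‖x‖² ≤ 2‖x - Px‖² + 2‖Px‖²` and `(‖Gx‖ + ‖Rx‖)² ≤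
  -- 2(‖Gx‖² + ‖Rx‖²)`.
  have key : ∀ x, ‖x‖ ^ 2 ≤ (4 * C ^ 2 + 2) * (‖G x‖ ^ 2 + ‖R x‖ ^ 2 + ‖P x‖ ^ 2) := fun x => by
    have h0 : P (x - P x) = 0 := by rw [map_sub, hPP, sub_self]
    have h1 := hC _ h0
    rw [map_sub, map_sub, hGP, hRP, sub_zero, sub_zero] at h1
    have h2 : ‖x‖ ≤ ‖x - P x‖ + ‖P x‖ := by
      simpa using norm_add_le (x - P x) (P x)
    have h3 : ‖x - P x‖ ^ 2 ≤ (C * (‖G x‖ + ‖R x‖)) ^ 2 :=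
      pow_le_pow_left₀ (norm_nonneg _) h1 2
    have h4 : ‖x‖ ^ 2 ≤ (‖x - P x‖ + ‖P x‖) ^ 2 := pow_le_pow_left₀ (norm_nonneg _) h2 2
    have h5 : (‖G x‖ + ‖R x‖) ^ 2 ≤ 2 * (‖G x‖ ^ 2 + ‖R x‖ ^ 2) := by
      nlinarith [sq_nonneg (‖G x‖ - ‖R x‖)]
    have h6 : (C * (‖G x‖ + ‖R x‖)) ^ 2 ≤ C ^ 2 * (2 * (‖G x‖ ^ 2 + ‖R x‖ ^ 2)) := by
      rw [mul_pow]
      exact mul_le_mul_of_nonneg_left h5 (sq_nonneg C)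
    nlinarith [sq_nonneg (‖x - P x‖ - ‖P x‖), mul_nonneg (sq_nonneg C) (sq_nonneg ‖P x‖),
      sq_nonneg ‖G x‖, sq_nonneg ‖R x‖]
  have hpos : 0 < 4 * C ^ 2 + 2 := by positivity
  have hunit : IsUnit E := by
    refine ContinuousLinearMap.isUnit_of_forall_le_norm_inner_map E
      (c := Real.toNNReal (4 * C ^ 2 + 2)⁻¹) (Real.toNNReal_pos.2 (inv_pos.2 hpos)) fun x => ?_
    refine le_trans ?_ (Complex.re_le_norm _)
    rw [hre, Real.coe_toNNReal _ (inv_pos.2 hpos).le, ← div_eq_mul_inv, div_le_iff₀ hpos, mul_comm]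
    exact key x
  obtain ⟨F, hF⟩ := hunit.exists_right_inv
  have hx : E (F b) = b := by
    have := congrArg (fun L : H →L[ℂ] H => L b) hF
    simpa using this
  -- All other summands of `E`, and `b`, are annihilated by `P`, so the auxiliary summand vanishes
  -- on the solution.
  have hPx : P (F b) = 0 := by
    have := congrArg P hx
    rw [hE, map_add, map_add, map_add, map_smul, hPG, hPR, hPP, hPN, hb] at this
    simpa using this
  refine ⟨F b, hPx, ?_⟩
  rw [hE, hPx, add_zero] at hx
  exact hx

/-- An operator given in block form by bounded operators is densely defined and self-adjoint. -/
theorem dense_and_isSelfAdjoint_of_block (T : H →ₗ.[ℂ] H) {P R G N : H →L[ℂ] H}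
    (hP : ∀ x y, inner ℂ (P x) y = inner ℂ x (P y))
    (hPP : ∀ x, P (P x) = P x) (hR : ∀ x y, inner ℂ (R x) y = inner ℂ x (R y))
    (hPR : ∀ x, P (R x) = 0) (hN : ∀ x y, inner ℂ (N x) y = inner ℂ x (N y))
    (hPN : ∀ x, P (N x) = 0) (hGP : ∀ x, G (P x) = 0) (hPG : ∀ x, P (G x) = G x) {C : ℝ}
    (hC : ∀ x, P x = 0 → ‖x‖ ≤ C * (‖G x‖ + ‖R x‖))
    (hdom : ∀ ψ : T.domain, ∃ x, P x = 0 ∧ (ψ : H) - P ψ = R x)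
    (hval : ∀ (ψ : T.domain) (x : H), P x = 0 → (ψ : H) - P ψ = R x →
      P (T ψ) = G x ∧ R (T ψ) = G.adjoint ψ + N x)
    (hmem : ∀ (ψ η x : H), P x = 0 → ψ - P ψ = R x → P η = G x → R η = G.adjoint ψ + N x →
      ∃ h : ψ ∈ T.domain, T ⟨ψ, h⟩ = η) :
    Dense (T.domain : Set H) ∧ IsSelfAdjoint T := by
  have hsym : ∀ x y : T.domain, inner ℂ (T x) (y : H) = inner ℂ (x : H) (T y) := by
    intro ψ φ
    obtain ⟨x, hx, hψ⟩ := hdom ψ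
    obtain ⟨y, hy, hφ⟩ := hdom φ
    obtain ⟨h1, h2⟩ := hval ψ x hx hψ
    obtain ⟨g1, g2⟩ := hval φ y hy hφ
    have hψ' : (ψ : H) = P ψ + R x := by rw [← hψ]; abel
    have hφ' : (φ : H) = P φ + R y := by rw [← hφ]; abel
    -- Both forms equal the two `G` cross terms plus an `N` term. Moving `R` from `R y` onto `T ψ`
    -- is what makes only bounded operators appear.
    have e1 : inner ℂ (T ψ) (φ : H)
        = inner ℂ (G x) (φ : H) + inner ℂ (ψ : H) (G y) + inner ℂ (N x) y := by
      nth_rewrite 1 [hφ']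
      rw [inner_add_right, ← hP, ← hR, h1, h2, inner_add_left,
        ContinuousLinearMap.adjoint_inner_left, add_assoc]
    have e2 : inner ℂ (ψ : H) (T φ)
        = inner ℂ (ψ : H) (G y) + inner ℂ (G x) (φ : H) + inner ℂ x (N y) := by
      nth_rewrite 1 [hψ']
      rw [inner_add_left, hP, hR, g1, g2, inner_add_right,
        ContinuousLinearMap.adjoint_inner_right, add_assoc]
    rw [e1, e2, hN]
    ring
  have hsurj : ∀ s : ℝ, s * s = 1 → ∀ η : H, ∃ ψ : T.domain,
      T ψ - ((s : ℂ) * Complex.I) • (ψ : H) = η := by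
    intro s hs η
    have hPGa : ∀ x, P (G.adjoint x) = 0 := fun x => by
      rw [← inner_self_eq_zero (𝕜 := ℂ), hP, ContinuousLinearMap.adjoint_inner_left, hPP, hGP,
        inner_zero_right]
    have hRP : ∀ x, R (P x) = 0 := fun x => by
      rw [← inner_self_eq_zero (𝕜 := ℂ), hR, hP, hPR, inner_zero_right]
    have hGaQ : ∀ x, G.adjoint (P x) = G.adjoint x := fun x => by
      refine ext_inner_right ℂ fun v => ?_
      rw [ContinuousLinearMap.adjoint_inner_left, ContinuousLinearMap.adjoint_inner_left, hP, hPG]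
    set c : ℂ := (s : ℂ) * Complex.I with hc
    have hcc : c * c = -1 := by
      have : (s : ℂ) * s = 1 := by exact_mod_cast hs
      rw [hc]
      linear_combination Complex.I * Complex.I * this + Complex.I_mul_I
    -- This is the `R`-component of `(T - c) ψ = η`, multiplied by `c`, after elimination of `P ψ`.
    obtain ⟨x, hx, hxe⟩ := exists_resolvent_solution hP hPP hR hPR hN hPN hGP hC s
      (c • R η + G.adjoint (P η)) (by rw [map_add, map_smul, hPR, hPGa]; simp)
    -- The `P`-component reads `G x - c P ψ = P η`, and `1/c = -c` because `c² = -1`.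
    set ψ : H := -c • (G x - P η) + R x with hψ
    have hPψ : P ψ = -c • (G x - P η) := by
      rw [hψ, map_add, hPR, map_smul, map_sub, hPG, hPP, add_zero]
    obtain ⟨h, hT⟩ := hmem ψ (η + c • ψ) x hx (by rw [hPψ, hψ]; abel) (by
        rw [map_add, map_smul, hPψ, smul_smul, mul_neg, hcc]
        simp) (by
        have e1 : G.adjoint ψ = -c • (G.adjoint (G x) - G.adjoint (P η)) := by
          rw [← hGaQ, hPψ, map_smul, map_sub]
        have e2 : R ψ = R (R x) := by
          rw [hψ, map_add, map_smul, map_sub, ← hPG, hRP, hRP]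
          simp
        rw [map_add, map_smul, e1, e2]
        have e3 : c • N x = c • R η + G.adjoint (P η) - G.adjoint (G x) - R (R x) := by
          rw [← hxe]; abel
        have e4 : N x = -c • (c • N x) := by
          rw [smul_smul, neg_mul, hcc, neg_neg, one_smul]
        rw [e4, e3]
        have e5 : -c • c • R η = R η := by rw [smul_smul, neg_mul, hcc, neg_neg, one_smul]
        simp only [smul_sub, smul_add, e5]
        simp only [neg_smul]
        abel)
    exact ⟨⟨ψ, h⟩, by rw [hT]; simp⟩
  have hm : ∀ η : H, ∃ x : T.domain, T x - Complex.I • (x : H) = η := by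
    simpa using hsurj 1 (by norm_num)
  have hp : ∀ η : H, ∃ x : T.domain, T x + Complex.I • (x : H) = η := by
    simpa using hsurj (-1) (by norm_num)
  exact ⟨dense_domain_of_surjective T hsym hm hp, isSelfAdjoint_of_surjective T hsym hm hp⟩

end Abstract

/-! ### Vectors and sequences of functions -/

theorem SeqEq.rfl' {f : Seq} : SeqEq f f := fun _ => Filter.EventuallyEq.rfl

/-- All components are measurable up to null sets. -/
def Meas (f : Seq) : Prop := ∀ n, AEStronglyMeasurable (f n) (volume : Measure (Config n))

/-- The square of the norm of a sequence of functions. -/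
def sqNorm (f : Seq) : ℝ≥0∞ := ∑' n, ∫⁻ x : Config n, ‖f n x‖ₑ ^ 2

theorem sqNorm_congr {f g : Seq} (h : SeqEq f g) : sqNorm f = sqNorm g := by
  unfold sqNorm
  refine tsum_congr fun n => lintegral_congr_ae ?_
  filter_upwards [h n] with x hx
  rw [hx]

theorem lintegral_sq_eq {n : ℕ} (f : Config n → ℂ) :
    ∫⁻ x : Config n, ‖f x‖ₑ ^ 2 = eLpNorm f 2 volume ^ 2 := by
  rw [eLpNorm_eq_lintegral_rpow_enorm_toReal (by norm_num) (by norm_num)]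
  simp only [ENNReal.toReal_ofNat, one_div]
  rw [← ENNReal.rpow_natCast _ 2, ← ENNReal.rpow_mul]
  norm_num

/-- Norms with values in `[0, ∞]` allow estimates to be proved before anything is known to be
finite. -/
theorem finiteNorm_iff {f : Seq} : FiniteNorm f ↔ Meas f ∧ sqNorm f ≠ ∞ := by
  have hkey : ∀ n, MemLp (f n) 2 volume → ∫⁻ x : Config n, ‖f n x‖ₑ ^ 2
      = ENNReal.ofReal ((eLpNorm (f n) 2 volume).toReal ^ 2) := fun n hn => by
    rw [lintegral_sq_eq, ENNReal.ofReal_pow ENNReal.toReal_nonneg,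
      ENNReal.ofReal_toReal hn.eLpNorm_ne_top]
  constructor
  · rintro ⟨h1, h2⟩
    refine ⟨fun n => (h1 n).1, ?_⟩
    unfold sqNorm
    rw [tsum_congr fun n => hkey n (h1 n)]
    exact h2.tsum_ofReal_ne_top
  · rintro ⟨h1, h2⟩
    have h3 : ∀ n, MemLp (f n) 2 volume := fun n => by
      refine ⟨h1 n, ?_⟩
      have := ENNReal.ne_top_of_tsum_ne_top h2 n
      rw [lintegral_sq_eq] at this
      rw [lt_top_iff_ne_top]
      rintro h
      simp [h] at this
    refine ⟨h3, ?_⟩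
    unfold sqNorm at h2
    have := ENNReal.summable_toReal h2
    refine this.congr fun n => ?_
    rw [lintegral_sq_eq, ENNReal.toReal_pow]

theorem FiniteNorm.meas {f : Seq} (h : FiniteNorm f) : Meas f := (finiteNorm_iff.1 h).1

theorem rep_meas (ψ : Fock) : Meas (rep ψ) := fun n => (Lp.memLp (ψ n)).1

theorem rep_finiteNorm (ψ : Fock) : FiniteNorm (rep ψ) := by
  refine ⟨fun n => Lp.memLp (ψ n), ?_⟩
  have := (lp.memℓp ψ).summable (by norm_num)
  simpa [Lp.norm_def, rep] using this

theorem rep_toFock {f : Seq} (h : FiniteNorm f) : SeqEq (rep (toFock f h)) f := fun n =>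
  MemLp.coeFn_toLp (h.1 n)

theorem toFock_rep (ψ : Fock) : toFock (rep ψ) (rep_finiteNorm ψ) = ψ := by
  apply Subtype.ext
  funext n
  exact Lp.toLp_coeFn (ψ n) (Lp.memLp (ψ n))

theorem ext_rep {ψ φ : Fock} (h : SeqEq (rep ψ) (rep φ)) : ψ = φ := by
  rw [← toFock_rep ψ, ← toFock_rep φ]
  exact toFock_congr h _ _

theorem enorm_sq_eq (ψ : Fock) : ‖ψ‖ₑ ^ 2 = sqNorm (rep ψ) := by
  have h1 := lp.norm_rpow_eq_tsum (p := 2) (by norm_num) ψ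
  simp only [ENNReal.toReal_ofNat, Real.rpow_ofNat] at h1
  have h2 := (rep_finiteNorm ψ).2
  rw [← ofReal_norm, ← ENNReal.ofReal_pow (norm_nonneg _), h1,
    ENNReal.ofReal_tsum_of_nonneg (fun n => by positivity) (by simpa [Lp.norm_def, rep] using h2)]
  refine tsum_congr fun n => ?_
  rw [lintegral_sq_eq, ENNReal.ofReal_pow (norm_nonneg _), Lp.norm_def, rep,
    ENNReal.ofReal_toReal (Lp.eLpNorm_ne_top _)]

theorem rep_sub (ψ φ : Fock) : SeqEq (rep (ψ - φ)) (rep ψ - rep φ) := fun n =>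
  Lp.coeFn_sub (ψ n) (φ n)

theorem SeqEq.add {f g f' g' : Seq} (h : SeqEq f g) (h' : SeqEq f' g') :
    SeqEq (f + f') (g + g') := fun n => (h n).add (h' n)

theorem SeqEq.sub {f g f' g' : Seq} (h : SeqEq f g) (h' : SeqEq f' g') :
    SeqEq (f - f') (g - g') := fun n => (h n).sub (h' n)

/-- A linear map on sequences of functions that is bounded for the norm of the Hilbert space. -/
structure BoundedMap (L : Seq → Seq) : Prop where
  add : ∀ f g, L (f + g) = L f + L g
  smul : ∀ (c : ℂ) f, L (c • f) = c • L f
  congr : ∀ {f g}, SeqEq f g → SeqEq (L f) (L g)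
  meas : ∀ {f}, Meas f → Meas (L f)
  bound : ∃ C : NNReal, ∀ f, Meas f → sqNorm (L f) ≤ C * sqNorm f

theorem BoundedMap.finiteNorm {L : Seq → Seq} (h : BoundedMap L) {f : Seq} (hf : FiniteNorm f) :
    FiniteNorm (L f) := by
  rw [finiteNorm_iff] at hf ⊢
  obtain ⟨C, hC⟩ := h.bound
  exact ⟨h.meas hf.1, ne_top_of_le_ne_top (ENNReal.mul_ne_top ENNReal.coe_ne_top hf.2) (hC f hf.1)⟩

/-- The bounded operator that a bounded map on sequences of functions induces. -/
def BoundedMap.toCLM {L : Seq → Seq} (h : BoundedMap L) : Fock →L[ℂ] Fock :=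
  LinearMap.mkContinuousOfExistsBound
    { toFun := fun ψ => toFock (L (rep ψ)) (h.finiteNorm (rep_finiteNorm ψ))
      map_add' := fun ψ φ => by
        have := h.congr (rep_add ψ φ)
        rw [h.add] at this
        exact toFock_congr this _
          ((h.finiteNorm (rep_finiteNorm ψ)).add (h.finiteNorm (rep_finiteNorm φ)))
      map_smul' := fun c ψ => by
        have := h.congr (rep_smul c ψ)
        rw [h.smul] at this
        exact toFock_congr this _ ((h.finiteNorm (rep_finiteNorm ψ)).smul c) } <| by
    obtain ⟨C, hC⟩ := h.bound
    refine ⟨Real.sqrt C, fun ψ => ?_⟩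
    have h1 := hC (rep ψ) (rep_meas ψ)
    have h2 : ‖toFock (L (rep ψ)) (h.finiteNorm (rep_finiteNorm ψ))‖ₑ ^ 2 ≤ C * ‖ψ‖ₑ ^ 2 := by
      rw [enorm_sq_eq, enorm_sq_eq, sqNorm_congr (rep_toFock _)]
      exact h1
    have h3 : ‖toFock (L (rep ψ)) (h.finiteNorm (rep_finiteNorm ψ))‖ ^ 2 ≤ C * ‖ψ‖ ^ 2 := by
      have := ENNReal.toReal_mono (by finiteness) h2
      simpa using this
    change ‖toFock (L (rep ψ)) (h.finiteNorm (rep_finiteNorm ψ))‖ ≤ _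
    rw [← Real.sqrt_sq (norm_nonneg ψ), ← Real.sqrt_mul C.coe_nonneg]
    exact Real.le_sqrt_of_sq_le h3

theorem BoundedMap.rep_toCLM {L : Seq → Seq} (h : BoundedMap L) (ψ : Fock) :
    SeqEq (rep (h.toCLM ψ)) (L (rep ψ)) :=
  rep_toFock (h.finiteNorm (rep_finiteNorm ψ))

/-! ### Multiplication operators -/

/-- Multiplication by functions of the photon momenta. -/
def photonMul (u : (n : ℕ) → (Fin n → R3) → ℝ) (f : Seq) : Seq := fun n x => (u n x.1 : ℂ) * f n x

theorem photonMul_congr (u : (n : ℕ) → (Fin n → R3) → ℝ) {f g : Seq} (h : SeqEq f g) :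
    SeqEq (photonMul u f) (photonMul u g) := fun n => by
  filter_upwards [h n] with x hx
  simp only [photonMul, hx]

theorem photonMul_meas {u : (n : ℕ) → (Fin n → R3) → ℝ} (hu : ∀ n, Measurable (u n)) {f : Seq}
    (hf : Meas f) : Meas (photonMul u f) := fun n => by
  have : Measurable fun x : Config n => (u n x.1 : ℂ) :=
    Complex.measurable_ofReal.comp ((hu n).comp measurable_fst)
  exact this.aestronglyMeasurable.mul (hf n)

theorem boundedMap_photonMul {u : (n : ℕ) → (Fin n → R3) → ℝ} (hu : ∀ n, Measurable (u n))
    (hu1 : ∀ n k, |u n k| ≤ 1) : BoundedMap (photonMul u) where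
  add f g := by
    funext n x
    simp [photonMul, mul_add]
  smul c f := by
    funext n x
    simp [photonMul, mul_left_comm]
  congr h := photonMul_congr u h
  meas h := photonMul_meas hu h
  bound := by
    refine ⟨1, fun f _ => ?_⟩
    rw [ENNReal.coe_one, one_mul]
    refine ENNReal.tsum_le_tsum fun n => lintegral_mono fun x => ?_
    refine pow_le_pow_left₀ (zero_le) ?_ 2
    have h : ‖photonMul u f n x‖ ≤ ‖f n x‖ := by
      rw [photonMul, norm_mul, Complex.norm_real, Real.norm_eq_abs]
      exact mul_le_of_le_one_left (norm_nonneg _) (hu1 n _)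
    exact enorm_le_iff_norm_le.2 h

theorem inner_eq_tsum_integral (ψ φ : Fock) :
    inner ℂ ψ φ = ∑' n, ∫ x : Config n, rep φ n x * (starRingEnd ℂ) (rep ψ n x) := by
  rw [lp.inner_eq_tsum]
  refine tsum_congr fun n => ?_
  rw [L2.inner_def]
  rfl

/-- Real multipliers are unaffected by conjugation. -/
theorem inner_photonMul {u : (n : ℕ) → (Fin n → R3) → ℝ} {L : Fock →L[ℂ] Fock}
    (hL : ∀ ψ, SeqEq (rep (L ψ)) (photonMul u (rep ψ))) (ψ φ : Fock) :
    inner ℂ (L ψ) φ = inner ℂ ψ (L φ) := by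
  rw [inner_eq_tsum_integral, inner_eq_tsum_integral]
  refine tsum_congr fun n => integral_congr_ae ?_
  filter_upwards [hL ψ n, hL φ n] with x h1 h2
  rw [h1, h2]
  simp only [photonMul, map_mul, Complex.conj_ofReal]
  ring

/-- Testing the components of a vector against indicator functions. -/
theorem inner_single_indicator (ψ : Fock) (n : ℕ) {s : Set (Config n)} (hs : MeasurableSet s)
    (hμ : volume s ≠ ∞) :
    inner ℂ (lp.single 2 n (indicatorConstLp 2 hs hμ (1 : ℂ)) : Fock) ψ
      = ∫ x in s, rep ψ n x := by
  rw [lp.inner_single_left]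
  exact L2.inner_indicatorConstLp_one hs hμ _

/-! ### The functions `pₙ` and the sets `Fₙ` -/

/-- Removal of the `i`-th photon. -/
def drop {n : ℕ} (i : Fin (n + 1)) (k : Fin (n + 1) → R3) : Fin n → R3 := fun j => k (i.succAbove j)

@[simp] theorem drop_insertNth {n : ℕ} (i : Fin (n + 1)) (q : R3) (k : Fin n → R3) :
    drop i (i.insertNth (α := fun _ => R3) q k) = k := by
  funext j
  simp [drop]

theorem measurable_drop {n : ℕ} (i : Fin (n + 1)) :
    Measurable (drop i : (Fin (n + 1) → R3) → Fin n → R3) := by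
  unfold drop
  fun_prop

theorem measurable_pfun (n : ℕ) : Measurable (pfun n) := by
  unfold pfun
  fun_prop

theorem pfun_perm {n : ℕ} (k : Fin n → R3) (σ : Equiv.Perm (Fin n)) :
    pfun n (k ∘ σ) = pfun n k := by
  unfold pfun
  congr 1
  exact Equiv.prod_comp σ fun i => (‖k i‖ ^ 2 + 1) ^ 2

/-- Isolating different photons in the same product compares the values of `p` with one or the other
of them removed. -/
theorem pfun_succ {n : ℕ} (i : Fin (n + 1)) (k : Fin (n + 1) → R3) :
    pfun (n + 1) k = Real.exp 1 * (‖k i‖ ^ 2 + 1) ^ 2 * pfun n (drop i k) := by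
  unfold pfun drop
  rw [Fin.prod_univ_succAbove _ i]
  push_cast
  rw [Real.exp_add ((n : ℝ) + 1) 1]
  ring

theorem one_le_sq (q : R3) : 1 ≤ (‖q‖ ^ 2 + 1) ^ 2 := by
  nlinarith [sq_nonneg ‖q‖]

theorem exp_le_pfun {n : ℕ} (k : Fin n → R3) : Real.exp (n + 1) ≤ pfun n k := by
  unfold pfun
  refine le_mul_of_one_le_right (Real.exp_pos _).le ?_
  exact Finset.one_le_prod fun i _ => one_le_sq (k i)

theorem two_le_pfun {n : ℕ} (k : Fin n → R3) : 2 ≤ pfun n k := by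
  have h1 := exp_le_pfun k
  have h2 := Real.add_one_le_exp ((n : ℝ) + 1)
  have h3 : (0 : ℝ) ≤ n := n.cast_nonneg
  linarith

theorem pfun_pos {n : ℕ} (k : Fin n → R3) : 0 < pfun n k := by
  linarith [two_le_pfun k]

theorem mul_sq_le_pfun {n : ℕ} (i : Fin n) (k : Fin n → R3) :
    (n + 1) * (‖k i‖ ^ 2 + 1) ^ 2 ≤ pfun n k := by
  obtain _ | n := n
  · exact i.elim0
  have h1 := exp_le_pfun (drop i k)
  have h3 : (0 : ℝ) ≤ n := n.cast_nonneg
  have h2 : ((n + 1 : ℕ) : ℝ) + 1 ≤ Real.exp 1 * Real.exp (n + 1) := by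
    rw [← Real.exp_add]
    have := Real.add_one_le_exp (1 + ((n : ℝ) + 1))
    push_cast
    linarith
  rw [pfun_succ i]
  have h4 : Real.exp 1 * (‖k i‖ ^ 2 + 1) ^ 2 * Real.exp (n + 1)
      ≤ Real.exp 1 * (‖k i‖ ^ 2 + 1) ^ 2 * pfun n (drop i k) :=
    mul_le_mul_of_nonneg_left h1 (by positivity)
  have h5 := mul_le_mul_of_nonneg_right h2 (sq_nonneg (‖k i‖ ^ 2 + 1))
  linarith

/-- The source of all Gaussian bounds: `e^{-p}` decays like `e^{-n - |k|²}` in each photon momentum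
that enters `p`. -/
theorem add_sq_le_pfun {n : ℕ} (i : Fin n) (k : Fin n → R3) : n + ‖k i‖ ^ 2 ≤ pfun n k := by
  have h1 := mul_sq_le_pfun i k
  have h3 : (0 : ℝ) ≤ n := n.cast_nonneg
  nlinarith [sq_nonneg ‖k i‖, mul_nonneg h3 (sq_nonneg ‖k i‖),
    mul_nonneg h3 (sq_nonneg (‖k i‖ ^ 2)), sq_nonneg (‖k i‖ ^ 2)]

/-- `|k| ≤ (1 + |k|²)/2 ≤ p/2`. The shell thus lies beyond every photon that determines it. -/
theorem norm_lt_exp_half {n : ℕ} (i : Fin n) (k : Fin n → R3) :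
    ‖k i‖ < Real.exp (pfun n k / 2) := by
  have h1 := add_sq_le_pfun i k
  have h2 := Real.add_one_le_exp (pfun n k / 2)
  have h3 : (1 : ℝ) ≤ n := by
    exact_mod_cast i.pos
  nlinarith [sq_nonneg (‖k i‖ - 1)]

/-- The `i`-th photon lies in the shell that the others determine, and removing it leads out
of `F`. -/
def Big (n : ℕ) (i : Fin (n + 1)) (k : Fin (n + 1) → R3) : Prop :=
  1 ≤ n ∧ drop i k ∉ F n ∧ Real.exp (pfun n (drop i k) / 2) < ‖k i‖ ∧
    ‖k i‖ < Real.exp (pfun n (drop i k))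

/-! ### Permutations and measurability of `F` -/

theorem mem_symmetrize_perm {N : ℕ} {X : Set (Fin N → R3)} (k : Fin N → R3)
    (σ : Equiv.Perm (Fin N)) : k ∘ σ ∈ symmetrize X ↔ k ∈ symmetrize X := by
  constructor
  · rintro ⟨τ, h⟩
    exact ⟨τ.trans σ, h⟩
  · rintro ⟨τ, h⟩
    refine ⟨τ.trans σ.symm, ?_⟩
    convert h using 1
    funext j
    simp

theorem mem_F_perm {n : ℕ} (k : Fin n → R3) (σ : Equiv.Perm (Fin n)) : k ∘ σ ∈ F n ↔ k ∈ F n := by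
  match n with
  | 0 => rfl
  | 1 => rfl
  | n + 2 => exact mem_symmetrize_perm k σ

theorem exists_perm_castSucc {n : ℕ} (i : Fin (n + 1)) :
    ∃ σ : Equiv.Perm (Fin (n + 1)), σ (Fin.last n) = i ∧
      ∀ j, σ (Fin.castSucc j) = i.succAbove j := by
  refine ⟨(finSuccEquivLast (n := n)).trans (finSuccEquiv' i).symm, ?_, fun j => ?_⟩
  · simp
  · simp

/-- A permutation followed by deletion of the last photon is deletion of the photon moved there, up
to relabelling the rest. This removes the preference for the last place in the definition of `F`. -/
theorem exists_perm_drop {n : ℕ} (σ : Equiv.Perm (Fin (n + 1))) :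
    ∃ τ : Equiv.Perm (Fin n), ∀ k : Fin (n + 1) → R3,
      (fun j : Fin n => (k ∘ σ) j.castSucc) = drop (σ (Fin.last n)) k ∘ τ := by
  obtain ⟨ρ, h1, h2⟩ := exists_perm_castSucc (σ (Fin.last n))
  have hne : ∀ j : Fin n, σ j.castSucc ≠ σ (Fin.last n) := fun j h =>
    (Fin.castSucc_lt_last j).ne (σ.injective h)
  choose f hf using fun j => Fin.exists_succAbove_eq (hne j)
  have hinj : Function.Injective f := fun a b hab => by
    have : σ a.castSucc = σ b.castSucc := by rw [← hf a, ← hf b, hab]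
    exact Fin.castSucc_injective n (σ.injective this)
  refine ⟨Equiv.ofBijective f (Finite.injective_iff_bijective.1 hinj), fun k => ?_⟩
  funext j
  simp [drop, hf j]

/-- Both `p` and the previous set are permutation invariant, so only the choice of the photon put
last matters. The clause `1 ≤ n` in `Big` accounts for `F₁ = ∅`. -/
theorem mem_F_succ {n : ℕ} (k : Fin (n + 1) → R3) : k ∈ F (n + 1) ↔ ∃ i, Big n i k := by
  obtain _ | n := n
  · simp [F, Big]
  change k ∈ symmetrize _ ↔ _
  constructor
  · rintro ⟨σ, h1, h2⟩
    obtain ⟨τ, hτ⟩ := exists_perm_drop σ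
    refine ⟨σ (Fin.last _), by omega, ?_⟩
    rw [Set.mem_ofPred_eq, hτ, Set.mem_compl_iff, mem_F_perm] at h1
    rw [Eset, Set.mem_ofPred_eq, hτ, pfun_perm] at h2
    exact ⟨h1, h2⟩
  · rintro ⟨i, -, h1, h2⟩
    obtain ⟨σ, hσ, hσ'⟩ := exists_perm_castSucc i
    have hd : (fun j : Fin (n + 1) => (k ∘ σ) j.castSucc) = drop i k := by
      funext j
      simp [drop, hσ']
    refine ⟨σ, ?_, ?_⟩
    · rw [Set.mem_ofPred_eq, hd]
      exact h1
    · rw [Eset, Set.mem_ofPred_eq, hd]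
      simpa [hσ] using h2

theorem measurableSet_big_of {n : ℕ} (h : MeasurableSet (F n)) (i : Fin (n + 1)) :
    MeasurableSet {k | Big n i k} := by
  unfold Big
  have hp : Measurable fun k : Fin (n + 1) → R3 => pfun n (drop i k) :=
    (measurable_pfun n).comp (measurable_drop i)
  have hk : Measurable fun k : Fin (n + 1) → R3 => ‖k i‖ := by fun_prop
  refine (MeasurableSet.const _).inter (MeasurableSet.inter (measurable_drop i h.compl)
    (MeasurableSet.inter ?_ ?_))
  · exact measurableSet_lt (Real.measurable_exp.comp (hp.div_const 2)) hk
  · exact measurableSet_lt hk (Real.measurable_exp.comp hp)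

theorem measurableSet_F (n : ℕ) : MeasurableSet (F n) := by
  induction n with
  | zero => exact MeasurableSet.empty
  | succ n ih =>
    have : F (n + 1) = ⋃ i, {k | Big n i k} := by
      ext k
      simp [mem_F_succ]
    rw [this]
    exact MeasurableSet.iUnion fun i => measurableSet_big_of ih i

theorem measurableSet_big {n : ℕ} (i : Fin (n + 1)) : MeasurableSet {k | Big n i k} :=
  measurableSet_big_of (measurableSet_F n) i

/-! ### The large photon -/

theorem exists_drop_eq {n : ℕ} {i j : Fin (n + 1)} (h : i ≠ j) (k : Fin (n + 1) → R3) :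
    ∃ l : Fin n, drop j k l = k i := by
  obtain ⟨l, hl⟩ := Fin.exists_succAbove_eq h
  exact ⟨l, by rw [drop, hl]⟩

theorem Big.norm_lt {n : ℕ} {i j : Fin (n + 1)} {k : Fin (n + 1) → R3} (h : Big n i k)
    (hij : j ≠ i) : ‖k j‖ < ‖k i‖ := by
  obtain ⟨l, hl⟩ := exists_drop_eq hij k
  rw [← hl]
  exact (norm_lt_exp_half l _).trans h.2.2.1

theorem Big.unique {n : ℕ} {i j : Fin (n + 1)} {k : Fin (n + 1) → R3} (h : Big n i k)
    (h' : Big n j k) : i = j := by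
  by_contra hij
  exact lt_asymm (h.norm_lt (Ne.symm hij)) (h'.norm_lt hij)

/-- Removing any photon from a configuration in `F` leads out of `F`. -/
theorem Big.drop_notMem {n : ℕ} {i : Fin (n + 1)} {k : Fin (n + 1) → R3} (h : Big n i k)
    (j : Fin (n + 1)) : drop j k ∉ F n := by
  by_cases hij : i = j
  · exact hij ▸ h.2.1
  obtain _ | n := n
  · simp [F]
  rw [mem_F_succ]
  rintro ⟨l, hl⟩
  obtain ⟨m, hm⟩ := Fin.exists_succAbove_eq hij
  have hm' : drop j k m = k i := by rw [drop, hm]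
  by_cases hlm : l = m
  · subst hlm
    -- Here the large photon `kᵢ` would also be large after removal of `kⱼ`. With `p'` evaluated
    -- without both, expanding `p(k)` at `i` and at `j` gives `p = e(|kⱼ|² + 1)² p' ≥ 2p'`. Then
    -- `|kᵢ| > e^{p/2} ≥ e^{p'}` lies above the outer radius of the smaller shell.
    have h1 : pfun (n + 1) (drop i k) * (Real.exp 1 * (‖k i‖ ^ 2 + 1) ^ 2)
        = (Real.exp 1 * (‖k j‖ ^ 2 + 1) ^ 2) * pfun (n + 1) (drop j k) := by
      rw [← pfun_succ j k, pfun_succ i k]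
      ring
    rw [pfun_succ l (drop j k), hm'] at h1
    have h2 : pfun (n + 1) (drop i k)
        = Real.exp 1 * (‖k j‖ ^ 2 + 1) ^ 2 * pfun n (drop l (drop j k)) := by
      have : Real.exp 1 * (‖k i‖ ^ 2 + 1) ^ 2 ≠ 0 := by positivity
      exact mul_right_cancel₀ this (by linear_combination h1)
    have h3 : pfun n (drop l (drop j k)) ≤ pfun (n + 1) (drop i k) / 2 := by
      have h4 := pfun_pos (drop l (drop j k))
      have h5 : 2 ≤ Real.exp 1 * (‖k j‖ ^ 2 + 1) ^ 2 := by
        have := Real.add_one_le_exp (1 : ℝ)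
        nlinarith [one_le_sq (k j)]
      rw [h2]
      nlinarith
    have h6 := hl.2.2.2
    rw [hm'] at h6
    exact absurd (h6.trans_le (Real.exp_le_exp.2 h3)) (not_lt.2 h.2.2.1.le)
  · have h1 := hl.norm_lt (Ne.symm hlm)
    rw [hm'] at h1
    have h2 : j.succAbove l ≠ i := fun h' => hlm (Fin.succAbove_right_injective (h'.trans hm.symm))
    exact lt_asymm h1 (h.norm_lt h2)

/-- This is why `A` has no block from `T` to `T`: creation and annihilation change a configuration
by one photon. -/
theorem drop_notMem_F {n : ℕ} {k : Fin (n + 1) → R3} (h : k ∈ F (n + 1)) (j : Fin (n + 1)) :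
    drop j k ∉ F n := by
  obtain ⟨i, hi⟩ := (mem_F_succ k).1 h
  exact hi.drop_notMem j

theorem insertNth_notMem_F {n : ℕ} {k : Fin n → R3} (h : k ∈ F n) (i : Fin (n + 1)) (q : R3) :
    i.insertNth (α := fun _ => R3) q k ∉ F (n + 1) := fun h' => by
  have := drop_notMem_F h' i
  rw [drop_insertNth] at this
  exact this h

/-- Without photon `j`, `p` still contains the large photon, whose square exceeds `e^p ≥ p` for the
value of `p` without the large photon. Weights evaluated without a small created photon are thereby
controlled. -/
theorem Big.pfun_le {n : ℕ} {i j : Fin (n + 1)} {k : Fin (n + 1) → R3} (h : Big n i k)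
    (hij : i ≠ j) : pfun n (drop i k) ≤ pfun n (drop j k) := by
  obtain ⟨l, hl⟩ := exists_drop_eq hij k
  have h1 := add_sq_le_pfun l (drop j k)
  rw [hl] at h1
  have h2 := h.2.2.1
  have h3 := Real.add_one_le_exp (pfun n (drop i k) / 2)
  have h4 := pfun_pos (drop i k)
  have h5 : (0 : ℝ) ≤ n := n.cast_nonneg
  nlinarith

theorem big_insertNth {n : ℕ} (i : Fin (n + 1)) (q : R3) (k : Fin n → R3) :
    Big n i (i.insertNth (α := fun _ => R3) q k) ↔
      (1 ≤ n ∧ k ∉ F n) ∧ (Real.exp (pfun n k / 2) < ‖q‖ ∧ ‖q‖ < Real.exp (pfun n k)) := by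
  rw [Big, drop_insertNth, Fin.insertNth_apply_same, and_assoc]

/-! ### Creation operators with a kernel -/

/-- The form factor `|q|^{-1/2}`. -/
def formFactor (q : R3) : ℝ := (Real.sqrt ‖q‖)⁻¹

theorem measurable_formFactor : Measurable formFactor := by
  unfold formFactor
  fun_prop

/-- Multipliers for the terms of the creation operators. -/
abbrev Kernel : Type := (n : ℕ) → Fin (n + 1) → (Fin (n + 1) → R3) → ℝ

/-- The `i`-th term of a creation operator with multiplier. -/
def crTerm (m : Kernel) (n : ℕ) (i : Fin (n + 1)) (f : Config n → ℂ) (y : Config (n + 1)) : ℂ :=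
  (m n i y.1 : ℂ) * ((formFactor (y.1 i) : ℂ) * f (drop i y.1, y.2 + y.1 i))

/-- The creation operator with the terms multiplied by `m`. -/
def cr (m : Kernel) (f : Seq) : Seq
  | 0 => 0
  | n + 1 => fun y => (((Real.sqrt (n + 1))⁻¹ : ℝ) : ℂ) * ∑ i, crTerm m n i (f n) y

/-- The annihilation operator with the integrands multiplied by `m`. -/
def an (m : Kernel) (g : Seq) : Seq := fun n x =>
  (((Real.sqrt (n + 1))⁻¹ : ℝ) : ℂ) * ∑ i : Fin (n + 1), ∫ q : R3,
    (m n i (i.insertNth (α := fun _ => R3) q x.1) : ℂ) * integrand n (g (n + 1)) i x q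

/-- The square integral of the `i`-th term of a kernel over the created photon. -/
def shell (m : Kernel) (n : ℕ) (i : Fin (n + 1)) (k : Fin n → R3) : ℝ≥0∞ :=
  ∫⁻ q : R3, ‖m n i (i.insertNth (α := fun _ => R3) q k)‖ₑ ^ 2 * ‖formFactor q‖ₑ ^ 2

/-- The configuration with the photon `q` inserted at the `i`-th place. -/
abbrev ins {n : ℕ} (i : Fin (n + 1)) (z : Config n × R3) : Config (n + 1) :=
  (i.insertNth (α := fun _ => R3) z.2 z.1.1, z.1.2 - z.2)

/-- Transferring momentum between photon and fermion is a shear, so the change of variables has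
Jacobian one. -/
theorem lintegral_insert {n : ℕ} (i : Fin (n + 1)) {φ : Config (n + 1) → ℝ≥0∞}
    (hφ : AEMeasurable φ volume) :
    ∫⁻ y, φ y = ∫⁻ x : Config n, ∫⁻ q : R3, φ (ins i (x, q)) := by
  have hp := measurePreserving_insert n i
  have h1 : ∫⁻ y, φ y = ∫⁻ z : Config n × R3, φ (ins i z) ∂(volume.prod volume) := by
    have hφ' := hφ
    rw [← hp.map_eq] at hφ' ⊢
    exact lintegral_map' hφ' hp.aemeasurable
  rw [h1, lintegral_prod]
  exact hφ.comp_quasiMeasurePreserving hp.quasiMeasurePreserving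

theorem crTerm_ins (m : Kernel) {n : ℕ} (i : Fin (n + 1)) (f : Config n → ℂ) (x : Config n)
    (q : R3) : crTerm m n i f (ins i (x, q))
      = (m n i (i.insertNth (α := fun _ => R3) q x.1) : ℂ) * ((formFactor q : ℂ) * f x) := by
  simp [crTerm]

theorem crTerm_meas {m : Kernel} (hm : ∀ n i, Measurable (m n i)) {n : ℕ} (i : Fin (n + 1))
    {f : Config n → ℂ} (hf : AEStronglyMeasurable f volume) :
    AEStronglyMeasurable (crTerm m n i f) volume := by
  unfold crTerm
  have h1 : Measurable fun y : Config (n + 1) => (m n i y.1 : ℂ) :=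
    Complex.measurable_ofReal.comp ((hm n i).comp measurable_fst)
  have h2 : Measurable fun y : Config (n + 1) => (formFactor (y.1 i) : ℂ) :=
    Complex.measurable_ofReal.comp (measurable_formFactor.comp (by fun_prop))
  exact h1.aestronglyMeasurable.mul (h2.aestronglyMeasurable.mul
    (hf.comp_quasiMeasurePreserving (quasiMeasurePreserving_remove n i)))

theorem measurable_insertNth {n : ℕ} (i : Fin (n + 1)) :
    Measurable fun z : (Fin n → R3) × R3 => i.insertNth (α := fun _ => R3) z.2 z.1 := by
  rw [measurable_pi_iff]
  intro j
  rcases Fin.eq_self_or_eq_succAbove i j with h | ⟨l, h⟩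
  · subst h
    simpa using measurable_snd
  · subst h
    simp only [Fin.insertNth_apply_succAbove]
    fun_prop

/-- In the variables `(x, q)` with `q` the created photon, the factor `f x` does not depend on `q`,
and the inner integral is `shell`. -/
theorem lintegral_crTerm {m : Kernel} (hm : ∀ n i, Measurable (m n i)) {n : ℕ} (i : Fin (n + 1))
    {f : Config n → ℂ} (hf : AEStronglyMeasurable f volume) :
    ∫⁻ y, ‖crTerm m n i f y‖ₑ ^ 2 = ∫⁻ x : Config n, ‖f x‖ₑ ^ 2 * shell m n i x.1 := by
  rw [lintegral_insert i ((crTerm_meas hm i hf).enorm.pow_const 2)]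
  refine lintegral_congr fun x => ?_
  unfold shell
  rw [← lintegral_const_mul]
  · refine lintegral_congr fun q => ?_
    rw [crTerm_ins, enorm_mul, enorm_mul, mul_pow, mul_pow]
    have e : ∀ r : ℝ, ‖(r : ℂ)‖ₑ = ‖r‖ₑ := fun r => by
      rw [← ofReal_norm, ← ofReal_norm, Complex.norm_real]
    rw [e, e]
    ring
  · have h1 : Measurable fun q : R3 => m n i (i.insertNth (α := fun _ => R3) q x.1) :=
      (hm n i).comp ((measurable_insertNth i).comp (measurable_const.prodMk measurable_id))
    exact (h1.enorm.pow_const 2).mul (measurable_formFactor.enorm.pow_const 2)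

theorem enorm_sq_ofReal (z : ℂ) : ‖z‖ₑ ^ 2 = ENNReal.ofReal (‖z‖ ^ 2) := by
  rw [← ofReal_norm, ENNReal.ofReal_pow (norm_nonneg _)]

theorem norm_inv_sqrt_sq (n : ℕ) :
    ‖(((Real.sqrt (n + 1))⁻¹ : ℝ) : ℂ)‖ ^ 2 = ((n : ℝ) + 1)⁻¹ := by
  rw [Complex.norm_real, Real.norm_eq_abs, sq_abs, inv_pow, Real.sq_sqrt (by positivity)]

/-- Cauchy–Schwarz: the number of terms cancels the squared prefactor. -/
theorem enorm_mean_sq_le {n : ℕ} (a : Fin (n + 1) → ℂ) :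
    ‖(((Real.sqrt (n + 1))⁻¹ : ℝ) : ℂ) * ∑ i, a i‖ₑ ^ 2 ≤ ∑ i, ‖a i‖ₑ ^ 2 := by
  simp only [enorm_sq_ofReal]
  rw [← ENNReal.ofReal_sum_of_nonneg fun i _ => by positivity]
  refine ENNReal.ofReal_le_ofReal ?_
  rw [norm_mul, mul_pow, norm_inv_sqrt_sq, inv_mul_le_iff₀ (by positivity)]
  have h1 : ‖∑ i, a i‖ ^ 2 ≤ (∑ i, ‖a i‖) ^ 2 :=
    pow_le_pow_left₀ (norm_nonneg _) (norm_sum_le _ _) 2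
  have h2 := sq_sum_le_card_mul_sum_sq (s := Finset.univ) (f := fun i => ‖a i‖)
  simp only [Finset.card_univ, Fintype.card_fin] at h2
  push_cast at h2
  exact h1.trans h2

/-- With at most one nonzero term there are no cross terms. The resulting equality is what later
provides lower bounds. -/
theorem enorm_mean_sq_of_unique {n : ℕ} (a : Fin (n + 1) → ℂ)
    (h : ∀ i j, a i ≠ 0 → a j ≠ 0 → i = j) :
    ‖(((Real.sqrt (n + 1))⁻¹ : ℝ) : ℂ) * ∑ i, a i‖ₑ ^ 2
      = ENNReal.ofReal ((n : ℝ) + 1)⁻¹ * ∑ i, ‖a i‖ₑ ^ 2 := by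
  rw [enorm_mul, mul_pow, enorm_sq_ofReal, norm_inv_sqrt_sq]
  congr 1
  by_cases h0 : ∃ i, a i ≠ 0
  · obtain ⟨i, hi⟩ := h0
    have hz : ∀ j, j ≠ i → a j = 0 := fun j hj => by
      by_contra hne
      exact hj (h j i hne hi)
    rw [Finset.sum_eq_single i (fun j _ hj => hz j hj) (by simp),
      Finset.sum_eq_single i (fun j _ hj => by simp [hz j hj]) (by simp)]
  · push Not at h0
    simp [h0]

theorem lintegral_cr_le {m : Kernel} (hm : ∀ n i, Measurable (m n i)) {f : Seq} (hf : Meas f)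
    (n : ℕ) : ∫⁻ y, ‖cr m f (n + 1) y‖ₑ ^ 2
      ≤ ∑ i, ∫⁻ x : Config n, ‖f n x‖ₑ ^ 2 * shell m n i x.1 := by
  calc _ ≤ ∫⁻ y, ∑ i, ‖crTerm m n i (f n) y‖ₑ ^ 2 := lintegral_mono fun y => enorm_mean_sq_le _
    _ = ∑ i, ∫⁻ y, ‖crTerm m n i (f n) y‖ₑ ^ 2 :=
      lintegral_finsetSum' _ fun i _ => (crTerm_meas hm i (hf n)).enorm.pow_const 2
    _ = _ := Finset.sum_congr rfl fun i _ => lintegral_crTerm hm i (hf n)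

theorem lintegral_cr_of_unique {m : Kernel} (hm : ∀ n i, Measurable (m n i))
    (hu : ∀ n k i j, m n i k ≠ 0 → m n j k ≠ 0 → i = j) {f : Seq} (hf : Meas f)
    (n : ℕ) : ∫⁻ y, ‖cr m f (n + 1) y‖ₑ ^ 2
      = ENNReal.ofReal ((n : ℝ) + 1)⁻¹ *
        ∑ i, ∫⁻ x : Config n, ‖f n x‖ₑ ^ 2 * shell m n i x.1 := by
  calc _ = ∫⁻ y, ENNReal.ofReal ((n : ℝ) + 1)⁻¹ * ∑ i, ‖crTerm m n i (f n) y‖ₑ ^ 2 := by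
        refine lintegral_congr fun y => enorm_mean_sq_of_unique _ fun i j hi hj => ?_
        refine hu n y.1 i j (fun h0 => hi ?_) fun h0 => hj ?_
        · simp [crTerm, h0]
        · simp [crTerm, h0]
    _ = ENNReal.ofReal ((n : ℝ) + 1)⁻¹ * ∫⁻ y, ∑ i, ‖crTerm m n i (f n) y‖ₑ ^ 2 :=
      lintegral_const_mul' _ _ ENNReal.ofReal_ne_top
    _ = _ := by
      rw [lintegral_finsetSum' _ fun i _ => (crTerm_meas hm i (hf n)).enorm.pow_const 2]
      congr 1
      exact Finset.sum_congr rfl fun i _ => lintegral_crTerm hm i (hf n)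

theorem sum_fin_const_mul {n : ℕ} (c : ℝ≥0∞) :
    ENNReal.ofReal ((n : ℝ) + 1)⁻¹ * ∑ _i : Fin (n + 1), c = c := by
  rw [Finset.sum_const, Finset.card_univ, Fintype.card_fin, nsmul_eq_mul, ← mul_assoc]
  have h : ENNReal.ofReal ((n : ℝ) + 1)⁻¹ * ((n + 1 : ℕ) : ℝ≥0∞) = 1 := by
    rw [← ENNReal.ofReal_natCast, ← ENNReal.ofReal_mul (by positivity)]
    push_cast
    rw [inv_mul_cancel₀ (by positivity), ENNReal.ofReal_one]
  rw [h, one_mul]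

theorem crTerm_congr (m : Kernel) {n : ℕ} (i : Fin (n + 1)) {f g : Config n → ℂ}
    (h : f =ᵐ[volume] g) : crTerm m n i f =ᵐ[volume] crTerm m n i g := by
  filter_upwards [(quasiMeasurePreserving_remove n i).ae h] with y hy
  change _ * (_ * f (drop i y.1, y.2 + y.1 i)) = _ * (_ * g (drop i y.1, y.2 + y.1 i))
  have : f (drop i y.1, y.2 + y.1 i) = g (drop i y.1, y.2 + y.1 i) := hy
  rw [this]

theorem cr_congr (m : Kernel) {f g : Seq} (h : SeqEq f g) : SeqEq (cr m f) (cr m g)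
  | 0 => Filter.EventuallyEq.rfl
  | n + 1 => by
    filter_upwards [ae_all_iff.2 fun i => crTerm_congr m i (h n)] with y hy
    simp only [cr, hy]

theorem cr_meas {m : Kernel} (hm : ∀ n i, Measurable (m n i)) {f : Seq} (hf : Meas f) :
    Meas (cr m f)
  | 0 => aestronglyMeasurable_const
  | n + 1 => by
    have : AEStronglyMeasurable (fun y => ∑ i, crTerm m n i (f n) y) volume :=
      Finset.aestronglyMeasurable_fun_sum _ fun i _ => crTerm_meas hm i (hf n)
    exact aestronglyMeasurable_const.mul this

theorem cr_add (m : Kernel) (f g : Seq) : cr m (f + g) = cr m f + cr m g := by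
  funext n y
  cases n with
  | zero => simp [cr]
  | succ n => simp [cr, crTerm, mul_add, Finset.sum_add_distrib]

theorem cr_smul (m : Kernel) (c : ℂ) (f : Seq) : cr m (c • f) = c • cr m f := by
  funext n y
  cases n with
  | zero => simp [cr]
  | succ n => simp [cr, crTerm, mul_left_comm _ c, Finset.mul_sum]

theorem boundedMap_cr {m : Kernel} (hm : ∀ n i, Measurable (m n i)) (C : NNReal)
    (hC : ∀ f, Meas f → ∀ n, ∫⁻ y, ‖cr m f (n + 1) y‖ₑ ^ 2 ≤ C * ∫⁻ x, ‖f n x‖ₑ ^ 2) :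
    BoundedMap (cr m) where
  add := cr_add m
  smul := cr_smul m
  congr := cr_congr m
  meas := cr_meas hm
  bound := by
    refine ⟨C, fun f hf => ?_⟩
    unfold sqNorm
    rw [tsum_eq_zero_add' ENNReal.summable, ← ENNReal.tsum_mul_left]
    have h0 : ∫⁻ x, ‖cr m f 0 x‖ₑ ^ 2 = 0 := by simp [cr]
    rw [h0, zero_add]
    exact ENNReal.tsum_le_tsum fun n => hC f hf n

theorem measurable_shell {m : Kernel} (hm : ∀ n i, Measurable (m n i)) (n : ℕ)
    (i : Fin (n + 1)) : Measurable (shell m n i) := by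
  unfold shell
  have h1 : Measurable fun z : (Fin n → R3) × R3 =>
      ‖m n i (i.insertNth (α := fun _ => R3) z.2 z.1)‖ₑ ^ 2 * ‖formFactor z.2‖ₑ ^ 2 :=
    Measurable.mul (((hm n i).comp (measurable_insertNth i)).enorm.pow_const 2)
      ((measurable_formFactor.comp measurable_snd).enorm.pow_const 2)
  exact h1.lintegral_prod_right'

theorem lintegral_cr_le_of_sum {m : Kernel} (hm : ∀ n i, Measurable (m n i)) {C : ℝ≥0∞}
    (hC : ∀ n k, ∑ i, shell m n i k ≤ C) {f : Seq} (hf : Meas f) (n : ℕ) :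
    ∫⁻ y, ‖cr m f (n + 1) y‖ₑ ^ 2 ≤ C * ∫⁻ x, ‖f n x‖ₑ ^ 2 := by
  refine (lintegral_cr_le hm hf n).trans ?_
  have hsh : ∀ i, AEMeasurable (fun x : Config n => ‖f n x‖ₑ ^ 2 * shell m n i x.1) volume :=
    fun i => ((hf n).enorm.pow_const 2).mul
      ((measurable_shell hm n i).comp measurable_fst).aemeasurable
  rw [← lintegral_finsetSum' _ fun i _ => hsh i]
  rw [← lintegral_const_mul'' C ((hf n).enorm.pow_const 2)]
  refine lintegral_mono fun x => ?_
  simp only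
  rw [← Finset.mul_sum, mul_comm]
  exact mul_le_mul_left (hC n x.1) _

/-! ### Adjoints -/

/-- A bounded shell integral puts the created indicator function in `L²`, and a product of `L²`
functions is integrable. -/
theorem integrable_crTerm_mul {m : Kernel} (hm : ∀ n i, Measurable (m n i)) {C : ℝ≥0∞}
    (hC : C ≠ ∞) {n : ℕ} {i : Fin (n + 1)} (hs : ∀ k, shell m n i k ≤ C) {g : Config (n + 1) → ℂ}
    (hg : MemLp g 2 volume) {s : Set (Config n)} (hsm : MeasurableSet s) (hμ : volume s ≠ ∞) :
    Integrable fun y => g y * crTerm m n i (s.indicator fun _ => (1 : ℂ)) y := by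
  have hind : AEStronglyMeasurable (s.indicator fun _ => (1 : ℂ)) (volume : Measure (Config n)) :=
    (measurable_const.indicator hsm).aestronglyMeasurable
  have hmem : MemLp (crTerm m n i (s.indicator fun _ => (1 : ℂ))) 2 volume := by
    refine ⟨crTerm_meas hm i hind, ?_⟩
    have h1 : ∫⁻ y, ‖crTerm m n i (s.indicator fun _ => (1 : ℂ)) y‖ₑ ^ 2 ≤ C * volume s := by
      rw [lintegral_crTerm hm i hind]
      calc _ ≤ ∫⁻ x, s.indicator (fun _ => C) x := by
            refine lintegral_mono fun x => ?_
            by_cases hx : x ∈ s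
            · simp [hx, hs]
            · simp [hx]
        _ = C * volume s := by rw [lintegral_indicator hsm, setLIntegral_const]
    have h2 : C * volume s ≠ ∞ := ENNReal.mul_ne_top hC hμ
    rw [lintegral_sq_eq] at h1
    rw [lt_top_iff_ne_top]
    intro h
    rw [h] at h1
    simp at h1
    exact h2 h1
  exact hg.integrable_mul hmem

theorem mul_crTerm_indicator_ins (m : Kernel) {n : ℕ} (i : Fin (n + 1)) (g : Config (n + 1) → ℂ)
    (s : Set (Config n)) (x : Config n) (q : R3) :
    g (ins i (x, q)) * crTerm m n i (s.indicator fun _ => (1 : ℂ)) (ins i (x, q))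
      = s.indicator (fun x => (m n i (i.insertNth (α := fun _ => R3) q x.1) : ℂ)
          * integrand n g i x q) x := by
  rw [crTerm_ins]
  by_cases hx : x ∈ s
  · simp only [hx, Set.indicator_of_mem, integrand, formFactor, ins]
    ring
  · simp [hx]

/-- Absolute convergence of the integrals of the adjoint, and its components tested against an
indicator function. -/
theorem integral_mul_crTerm {m : Kernel} (hm : ∀ n i, Measurable (m n i)) {C : ℝ≥0∞}
    (hC : C ≠ ∞) {n : ℕ} {i : Fin (n + 1)} (hs : ∀ k, shell m n i k ≤ C) {g : Config (n + 1) → ℂ}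
    (hg : MemLp g 2 volume) {s : Set (Config n)} (hsm : MeasurableSet s) (hμ : volume s ≠ ∞) :
    (∀ᵐ x : Config n, x ∈ s → Integrable fun q : R3 =>
      (m n i (i.insertNth (α := fun _ => R3) q x.1) : ℂ) * integrand n g i x q) ∧
    IntegrableOn (fun x => ∫ q : R3,
      (m n i (i.insertNth (α := fun _ => R3) q x.1) : ℂ) * integrand n g i x q) s ∧
    ∫ y, g y * crTerm m n i (s.indicator fun _ => (1 : ℂ)) y
      = ∫ x in s, ∫ q : R3,
        (m n i (i.insertNth (α := fun _ => R3) q x.1) : ℂ) * integrand n g i x q := by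
  have hp := measurePreserving_insert n i
  have h1 := integrable_crTerm_mul hm hC hs hg hsm hμ
  -- Pulled back to configuration and created photon, integrability yields by Fubini both the
  -- absolute convergence and the exchange of integrals.
  have h2 : Integrable (fun z : Config n × R3 => s.indicator (fun x =>
      (m n i (i.insertNth (α := fun _ => R3) z.2 x.1) : ℂ) * integrand n g i x z.2) z.1)
      (volume.prod volume) := by
    refine (hp.integrable_comp_of_integrable h1).congr (Filter.Eventually.of_forall fun z => ?_)
    exact mul_crTerm_indicator_ins m i g s z.1 z.2
  have h3 : ∀ x, ∫ q : R3, s.indicator (fun x =>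
      (m n i (i.insertNth (α := fun _ => R3) q x.1) : ℂ) * integrand n g i x q) x
      = s.indicator (fun x => ∫ q : R3,
        (m n i (i.insertNth (α := fun _ => R3) q x.1) : ℂ) * integrand n g i x q) x := fun x => by
    by_cases hx : x ∈ s <;> simp [hx]
  refine ⟨?_, ?_, ?_⟩
  · filter_upwards [h2.prod_right_ae] with x hx hxs
    simpa [hxs] using hx
  · rw [← integrable_indicator_iff hsm]
    refine h2.integral_prod_left.congr (Filter.Eventually.of_forall fun x => h3 x)
  · rw [← integral_indicator hsm]
    have h4 : ∫ y, g y * crTerm m n i (s.indicator fun _ => (1 : ℂ)) y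
        = ∫ z : Config n × R3, g (ins i z) *
          crTerm m n i (s.indicator fun _ => (1 : ℂ)) (ins i z) ∂(volume.prod volume) := by
      have h5 := h1.1
      rw [← hp.map_eq] at h5 ⊢
      exact integral_map hp.aemeasurable h5
    rw [h4]
    have h6 : ∀ z : Config n × R3, g (ins i z) *
          crTerm m n i (s.indicator fun _ => (1 : ℂ)) (ins i z) = s.indicator (fun x =>
      (m n i (i.insertNth (α := fun _ => R3) z.2 x.1) : ℂ) * integrand n g i x z.2) z.1 :=
      fun z => mul_crTerm_indicator_ins m i g s z.1 z.2
    rw [integral_congr_ae (Filter.Eventually.of_forall h6), integral_prod _ h2]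
    exact integral_congr_ae (Filter.Eventually.of_forall h3)

/-- The statement on sets of finite measure extends by exhaustion of the configuration space. -/
theorem an_absConv {m : Kernel} (hm : ∀ n i, Measurable (m n i)) {C : ℝ≥0∞}
    (hC : C ≠ ∞) (hs : ∀ n i k, shell m n i k ≤ C) (g : Fock) (n : ℕ) (i : Fin (n + 1)) :
    ∀ᵐ x : Config n, Integrable fun q : R3 =>
      (m n i (i.insertNth (α := fun _ => R3) q x.1) : ℂ) * integrand n (rep g (n + 1)) i x q := by
  have h : ∀ j : ℕ, ∀ᵐ x : Config n, x ∈ spanningSets volume j → Integrable fun q : R3 =>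
      (m n i (i.insertNth (α := fun _ => R3) q x.1) : ℂ)
        * integrand n (rep g (n + 1)) i x q := fun j =>
    (integral_mul_crTerm hm hC (hs n i) (Lp.memLp (g (n + 1))) (measurableSet_spanningSets _ j)
      (measure_spanningSets_lt_top _ j).ne).1
  filter_upwards [ae_all_iff.2 h] with x hx
  exact hx _ (mem_spanningSetsIndex volume x)

theorem rep_single_indicator (n : ℕ) {s : Set (Config n)} (hs : MeasurableSet s)
    (hμ : volume s ≠ ∞) :
    rep (lp.single 2 n (indicatorConstLp 2 hs hμ (1 : ℂ)) : Fock) n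
      =ᵐ[volume] s.indicator fun _ => (1 : ℂ) := by
  have h : rep (lp.single 2 n (indicatorConstLp 2 hs hμ (1 : ℂ)) : Fock) n
      = indicatorConstLp 2 hs hμ (1 : ℂ) := by
    simp [rep]
  rw [h]
  exact indicatorConstLp_coeFn

theorem rep_single_of_ne {n l : ℕ} (h : l ≠ n) (a : Lp ℂ 2 (volume : Measure (Config n))) :
    rep (lp.single 2 n a : Fock) l =ᵐ[volume] 0 := by
  have h : rep (lp.single 2 n a : Fock) l = (0 : Lp ℂ 2 (volume : Measure (Config l))) := by
    simp [rep, Pi.single_eq_of_ne h]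
  rw [h]
  exact Lp.coeFn_zero _ _ _

/-- The adjoint of a creation operator with kernel is the annihilation operator with the same
kernel. -/
theorem rep_adjoint_cr {m : Kernel} (hm : ∀ n i, Measurable (m n i)) {C : ℝ≥0∞}
    (hC : C ≠ ∞) (hs : ∀ n i k, shell m n i k ≤ C) (hb : BoundedMap (cr m)) (g : Fock) :
    SeqEq (rep (hb.toCLM.adjoint g)) (an m (rep g)) := by
  intro n
  have hI := fun (i : Fin (n + 1)) (s : Set (Config n)) (hsm : MeasurableSet s)
    (hμ : volume s < ∞) =>
    integral_mul_crTerm hm hC (hs n i) ((rep_finiteNorm g).1 (n + 1)) hsm hμ.ne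
  -- Component `n` is identified through its integrals over sets of finite measure, which are inner
  -- products with indicator vectors. Creation sends such a vector into component `n + 1` alone.
  refine ae_eq_of_forall_setIntegral_eq_of_sigmaFinite (fun s _ hμ => ?_)
    (fun s hsm hμ => ?_) fun s hsm hμ => ?_
  · have : IsFiniteMeasure (volume.restrict s) := ⟨by simpa using hμ⟩
    exact (((rep_finiteNorm (hb.toCLM.adjoint g)).1 n).restrict s).integrable (by norm_num)
  · exact (integrable_finsetSum _ fun i _ => (hI i s hsm hμ).2.1).const_mul _
  · set e : Fock := lp.single 2 n (indicatorConstLp 2 hsm hμ.ne (1 : ℂ)) with he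
    rw [← inner_single_indicator _ _ hsm hμ.ne, ← he, ContinuousLinearMap.adjoint_inner_right,
      inner_eq_tsum_integral, tsum_eq_single (n + 1)]
    · have h1 : ∀ᵐ y : Config (n + 1),
          rep g (n + 1) y * (starRingEnd ℂ) (rep (hb.toCLM e) (n + 1) y)
          = (((Real.sqrt (n + 1))⁻¹ : ℝ) : ℂ) * ∑ i, rep g (n + 1) y *
            crTerm m n i (s.indicator fun _ => (1 : ℂ)) y := by
        filter_upwards [hb.rep_toCLM e (n + 1),
          ae_all_iff.2 fun i => crTerm_congr m i (rep_single_indicator n hsm hμ.ne)] with y hy hy'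
        have hreal : ∀ i, (starRingEnd ℂ) (crTerm m n i (s.indicator fun _ => (1 : ℂ)) y)
            = crTerm m n i (s.indicator fun _ => (1 : ℂ)) y := fun i => by
          unfold crTerm
          rw [map_mul, map_mul, Complex.conj_ofReal, Complex.conj_ofReal]
          congr 2
          by_cases hx : (drop i y.1, y.2 + y.1 i) ∈ s <;> simp [hx]
        rw [hy, cr]
        simp only [he, hy', map_mul, map_sum, hreal, Complex.conj_ofReal]
        rw [← Finset.mul_sum]
        ring
      rw [integral_congr_ae h1, integral_const_mul, integral_finsetSum]
      · unfold an
        rw [integral_const_mul, integral_finsetSum _ fun i _ => (hI i s hsm hμ).2.1]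
        congr 1
        exact Finset.sum_congr rfl fun i _ => (hI i s hsm hμ).2.2
      · intro i _
        exact integrable_crTerm_mul hm hC (hs n i) (Lp.memLp (g (n + 1))) hsm hμ.ne
    · intro l hl
      refine integral_eq_zero_of_ae ?_
      have h0 : cr m (rep e) l =ᵐ[volume] 0 := by
        obtain _ | l := l
        · exact Filter.EventuallyEq.rfl
        have hne : l ≠ n := fun h => hl (by rw [h])
        filter_upwards [ae_all_iff.2 fun i => crTerm_congr m i (rep_single_of_ne hne
          (indicatorConstLp 2 hsm hμ.ne (1 : ℂ)))] with y hy
        simp only [cr, he, hy]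
        simp [crTerm]
      filter_upwards [hb.rep_toCLM e l, h0] with y hy hy'
      rw [hy, hy']
      simp

/-! ### Integrals of the form factor -/

theorem enorm_formFactor_sq (q : R3) : ‖formFactor q‖ₑ ^ 2 = ENNReal.ofReal ‖q‖⁻¹ := by
  rw [← ofReal_norm, ← ENNReal.ofReal_pow (norm_nonneg _), Real.norm_eq_abs, sq_abs, formFactor,
    inv_pow, Real.sq_sqrt (norm_nonneg _)]

/-- Half the area of the unit sphere. -/
def halfArea : ℝ := 3 * (volume : Measure R3).real (Metric.ball 0 1) / 2

theorem halfArea_pos : 0 < halfArea := by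
  have h : 0 < (volume : Measure R3).real (Metric.ball 0 1) :=
    ENNReal.toReal_pos (Metric.measure_ball_pos _ _ one_pos).ne' measure_ball_lt_top.ne
  unfold halfArea
  positivity

/-- In polar coordinates the density is `r² · r⁻¹ = r`, so the integral is the sphere's area times
`(b² - a²)/2`. -/
theorem lintegral_shell {a b : ℝ} (ha : 0 ≤ a) (hab : a ≤ b) :
    ∫⁻ q in {q : R3 | a < ‖q‖ ∧ ‖q‖ < b}, ‖formFactor q‖ₑ ^ 2
      = ENNReal.ofReal (halfArea * (b ^ 2 - a ^ 2)) := by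
  have hset : MeasurableSet {q : R3 | a < ‖q‖ ∧ ‖q‖ < b} :=
    (measurableSet_lt measurable_const measurable_norm).inter
      (measurableSet_lt measurable_norm measurable_const)
  set f : ℝ → ℝ := (Set.Ioo a b).indicator fun y => y⁻¹ with hf
  have h1 : ∀ q : R3, {q : R3 | a < ‖q‖ ∧ ‖q‖ < b}.indicator (fun q => ‖formFactor q‖ₑ ^ 2) q
      = ENNReal.ofReal (f ‖q‖) := fun q => by
    by_cases hq : q ∈ {q : R3 | a < ‖q‖ ∧ ‖q‖ < b}
    · have hq' : ‖q‖ ∈ Set.Ioo a b := hq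
      rw [Set.indicator_of_mem hq, enorm_formFactor_sq, hf, Set.indicator_of_mem hq']
    · have hq' : ‖q‖ ∉ Set.Ioo a b := hq
      rw [Set.indicator_of_notMem hq, hf, Set.indicator_of_notMem hq', ENNReal.ofReal_zero]
  have h2 : ∀ y ∈ Set.Ioi (0 : ℝ), y ^ (Module.finrank ℝ R3 - 1) • f y
      = (Set.Ioo a b).indicator (fun y => y) y := fun y hy => by
    have hy' : y ≠ 0 := ne_of_gt hy
    by_cases h : y ∈ Set.Ioo a b
    · simp only [hf, Set.indicator_of_mem h, finrank_euclideanSpace, Fintype.card_fin, smul_eq_mul]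
      field_simp
    · simp [hf, Set.indicator_of_notMem h]
  have hint : IntegrableOn (fun y : ℝ => y) (Set.Ioo a b) :=
    (continuous_id.integrableOn_Icc (a := a) (b := b)).mono_set Set.Ioo_subset_Icc_self
  have h3 : Integrable fun q : R3 => f ‖q‖ := by
    rw [integrable_fun_norm_addHaar volume, integrableOn_congr_fun h2 measurableSet_Ioi]
    exact ((integrable_indicator_iff measurableSet_Ioo).2 hint).integrableOn
  have hnn : 0 ≤ fun q : R3 => f ‖q‖ := fun q =>
    Set.indicator_nonneg (fun y hy => inv_nonneg.2 (ha.trans hy.1.le)) _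
  rw [← lintegral_indicator hset, lintegral_congr h1,
    ← ofReal_integral_eq_lintegral_ofReal h3 (Filter.Eventually.of_forall hnn),
    integral_fun_norm_addHaar volume, setIntegral_congr_fun measurableSet_Ioi h2,
    setIntegral_indicator measurableSet_Ioo]
  have h4 : Set.Ioi (0 : ℝ) ∩ Set.Ioo a b = Set.Ioo a b :=
    Set.inter_eq_right.2 fun y hy => ha.trans_lt hy.1
  rw [h4, ← integral_Ioc_eq_integral_Ioo, ← intervalIntegral.integral_of_le hab, integral_id]
  congr 1
  simp only [finrank_euclideanSpace, Fintype.card_fin, smul_eq_mul, nsmul_eq_mul, halfArea]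
  push_cast
  ring

/-- The radial density is `r e^{-r²}`: the singularity at the origin is harmless in dimension three.
-/
theorem lintegral_gaussian :
    ∫⁻ q : R3, ENNReal.ofReal (Real.exp (-‖q‖ ^ 2)) * ‖formFactor q‖ₑ ^ 2 ≠ ∞ := by
  have h1 : Integrable fun q : R3 => Real.exp (-‖q‖ ^ 2) * ‖q‖⁻¹ := by
    rw [integrable_fun_norm_addHaar volume (f := fun y => Real.exp (-y ^ 2) * y⁻¹)]
    have h2 := (integrable_mul_exp_neg_mul_sq (b := 1) one_pos).integrableOn (s := Set.Ioi 0)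
    refine h2.congr_fun (fun y hy => ?_) measurableSet_Ioi
    have hy' : y ≠ 0 := ne_of_gt hy
    simp only [finrank_euclideanSpace, Fintype.card_fin, smul_eq_mul]
    field_simp
  have h2 := h1.2
  rw [hasFiniteIntegral_iff_ofReal (Filter.Eventually.of_forall fun q => by positivity)] at h2
  refine ne_of_lt (lt_of_le_of_lt (lintegral_mono fun q => ?_) h2)
  simp only
  rw [enorm_formFactor_sq, ENNReal.ofReal_mul (Real.exp_pos _).le]

/-- The bound for kernels with Gaussian decay. -/
def gaussBound : NNReal :=
  (∫⁻ q : R3, ENNReal.ofReal (Real.exp (-‖q‖ ^ 2)) * ‖formFactor q‖ₑ ^ 2).toNNReal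

theorem shell_le_of_gaussian {m : Kernel} {n : ℕ} {i : Fin (n + 1)}
    (h : ∀ k, m n i k ^ 2 ≤ Real.exp (-(n + ‖k i‖ ^ 2))) (k : Fin n → R3) :
    shell m n i k ≤ ENNReal.ofReal (Real.exp (-n)) * gaussBound := by
  rw [gaussBound, ENNReal.coe_toNNReal lintegral_gaussian,
    ← lintegral_const_mul' _ _ ENNReal.ofReal_ne_top]
  refine lintegral_mono fun q => ?_
  simp only
  rw [← mul_assoc]
  refine mul_le_mul_left ?_ _
  rw [← ENNReal.ofReal_mul (Real.exp_pos _).le, ← Real.exp_add, ← ofReal_norm,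
    ← ENNReal.ofReal_pow (norm_nonneg _), Real.norm_eq_abs, sq_abs]
  refine ENNReal.ofReal_le_ofReal ((h _).trans (le_of_eq ?_))
  rw [Fin.insertNth_apply_same]
  ring_nf

theorem shell_le_gaussBound {m : Kernel} {n : ℕ} {i : Fin (n + 1)}
    (h : ∀ k, m n i k ^ 2 ≤ Real.exp (-(n + ‖k i‖ ^ 2))) (k : Fin n → R3) :
    shell m n i k ≤ gaussBound := by
  refine (shell_le_of_gaussian h k).trans (mul_le_of_le_one_left zero_le ?_)
  rw [ENNReal.ofReal_le_one, Real.exp_le_one_iff]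
  simp

/-- The sum over `n + 1` places is paid for by the decay in the photon number: `(n + 1) e^{-n} ≤ 1`.
-/
theorem boundedMap_cr_of_gaussian {m : Kernel} (hm : ∀ n i, Measurable (m n i))
    (h : ∀ n i k, m n i k ^ 2 ≤ Real.exp (-(n + ‖k i‖ ^ 2))) : BoundedMap (cr m) := by
  refine boundedMap_cr hm gaussBound fun f hf n => lintegral_cr_le_of_sum hm (fun n k => ?_) hf n
  refine (Finset.sum_le_sum fun i _ => shell_le_of_gaussian (h n i) k).trans ?_
  rw [Finset.sum_const, Finset.card_univ, Fintype.card_fin, nsmul_eq_mul, ← mul_assoc]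
  refine mul_le_of_le_one_left zero_le ?_
  rw [← ENNReal.ofReal_natCast, ← ENNReal.ofReal_mul (by positivity), ENNReal.ofReal_le_one,
    Real.exp_neg, ← div_eq_mul_inv, div_le_one (Real.exp_pos _)]
  push_cast
  exact Real.add_one_le_exp _

/-- The integral of the form factor over the shell that a configuration determines. -/
def shellInt {n : ℕ} (k : Fin n → R3) : ℝ≥0∞ :=
  ∫⁻ q in {q : R3 | Real.exp (pfun n k / 2) < ‖q‖ ∧ ‖q‖ < Real.exp (pfun n k)},
    ‖formFactor q‖ₑ ^ 2

theorem shellInt_eq {n : ℕ} (k : Fin n → R3) :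
    shellInt k = ENNReal.ofReal (halfArea * (Real.exp (2 * pfun n k) - Real.exp (pfun n k))) := by
  have h := pfun_pos k
  rw [shellInt, lintegral_shell (Real.exp_pos _).le (Real.exp_le_exp.2 (by linarith)),
    ← Real.exp_nat_mul, ← Real.exp_nat_mul]
  congr 4
  push_cast
  ring

theorem shellInt_le {n : ℕ} (k : Fin n → R3) :
    shellInt k ≤ ENNReal.ofReal (halfArea * Real.exp (2 * pfun n k)) := by
  rw [shellInt_eq]
  refine ENNReal.ofReal_le_ofReal (mul_le_mul_of_nonneg_left ?_ halfArea_pos.le)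
  linarith [Real.exp_pos (pfun n k)]

/-- Since `e^p ≥ 2`, the subtracted `e^p` is at most half of `e^{2p}`. With `shellInt_le`, the shell
integral is comparable to `e^{2p}`. -/
theorem le_shellInt {n : ℕ} (k : Fin n → R3) :
    ENNReal.ofReal (halfArea / 2 * Real.exp (2 * pfun n k)) ≤ shellInt k := by
  rw [shellInt_eq]
  refine ENNReal.ofReal_le_ofReal ?_
  rw [div_mul_eq_mul_div, mul_div_assoc]
  refine mul_le_mul_of_nonneg_left ?_ halfArea_pos.le
  have h := pfun_pos k
  have h1 := Real.add_one_le_exp (pfun n k)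
  have h2 := two_le_pfun k
  have h3 : Real.exp (2 * pfun n k) = Real.exp (pfun n k) * Real.exp (pfun n k) := by
    rw [← Real.exp_add]; ring_nf
  rw [h3]
  nlinarith

/-! ### Calculus of kernels -/

theorem sqNorm_add_le {f g : Seq} (hf : Meas f) :
    sqNorm (f + g) ≤ 2 * (sqNorm f + sqNorm g) := by
  unfold sqNorm
  rw [← ENNReal.tsum_add, ← ENNReal.tsum_mul_left]
  refine ENNReal.tsum_le_tsum fun n => ?_
  rw [← lintegral_add_left' ((hf n).enorm.pow_const 2), ← lintegral_const_mul' _ _ (by norm_num)]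
  refine lintegral_mono fun x => ?_
  simp only [enorm_sq_ofReal, Pi.add_apply]
  rw [← ENNReal.ofReal_add (by positivity) (by positivity), ← ENNReal.ofReal_ofNat 2,
    ← ENNReal.ofReal_mul (by norm_num)]
  refine ENNReal.ofReal_le_ofReal ?_
  have h := pow_le_pow_left₀ (norm_nonneg _) (norm_add_le (f n x) (g n x)) 2
  nlinarith [sq_nonneg (‖f n x‖ - ‖g n x‖)]

theorem FiniteNorm.sub {f g : Seq} (hf : FiniteNorm f) (hg : FiniteNorm g) :
    FiniteNorm (f - g) := by
  have : f - g = f + (-1 : ℂ) • g := by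
    rw [neg_one_smul, sub_eq_add_neg]
  rw [this]
  exact hf.add (hg.smul _)

theorem BoundedMap.comp {L L' : Seq → Seq} (h : BoundedMap L) (h' : BoundedMap L') :
    BoundedMap fun f => L (L' f) where
  add f g := by rw [h'.add, h.add]
  smul c f := by rw [h'.smul, h.smul]
  congr e := h.congr (h'.congr e)
  meas e := h.meas (h'.meas e)
  bound := by
    obtain ⟨C, hC⟩ := h.bound
    obtain ⟨C', hC'⟩ := h'.bound
    refine ⟨C * C', fun f hf => (hC _ (h'.meas hf)).trans ?_⟩
    rw [ENNReal.coe_mul, mul_assoc]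
    exact mul_le_mul_right (hC' f hf) _

theorem BoundedMap.sum {L L' : Seq → Seq} (h : BoundedMap L) (h' : BoundedMap L') :
    BoundedMap fun f => L f + L' f where
  add f g := by rw [h'.add, h.add]; abel
  smul c f := by rw [h'.smul, h.smul, smul_add]
  congr e := (h.congr e).add (h'.congr e)
  meas e n := (h.meas e n).add (h'.meas e n)
  bound := by
    obtain ⟨C, hC⟩ := h.bound
    obtain ⟨C', hC'⟩ := h'.bound
    refine ⟨2 * (C + C'), fun f hf => (sqNorm_add_le (h.meas hf)).trans ?_⟩
    have := add_le_add (hC f hf) (hC' f hf)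
    push_cast
    rw [mul_assoc, add_mul]
    exact mul_le_mul_right this _

/-- Multipliers on either side of a creation operator are absorbed into its kernel, evaluated with
or without the created photon. Operator identities thus become pointwise identities of kernels. -/
theorem photonMul_cr (u : (n : ℕ) → (Fin n → R3) → ℝ) (m : Kernel) (f : Seq) :
    photonMul u (cr m f) = cr (fun n i k => u (n + 1) k * m n i k) f := by
  funext n y
  cases n with
  | zero => simp [photonMul, cr]
  | succ n =>
    simp only [photonMul, cr, crTerm, Finset.mul_sum]
    refine Finset.sum_congr rfl fun i _ => ?_
    push_cast
    ring

theorem cr_photonMul (u : (n : ℕ) → (Fin n → R3) → ℝ) (m : Kernel) (f : Seq) :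
    cr m (photonMul u f) = cr (fun n i k => m n i k * u n (drop i k)) f := by
  funext n y
  cases n with
  | zero => simp [cr]
  | succ n =>
    simp only [photonMul, cr, crTerm, Finset.mul_sum]
    refine Finset.sum_congr rfl fun i _ => ?_
    push_cast
    ring

theorem cr_add_kernel (m m' : Kernel) (f : Seq) :
    cr (fun n i k => m n i k + m' n i k) f = cr m f + cr m' f := by
  funext n y
  cases n with
  | zero => simp [cr]
  | succ n => simp [cr, crTerm, add_mul, mul_add, Finset.sum_add_distrib]

theorem cr_zero_kernel (f : Seq) : cr (fun _ _ _ => 0) f = 0 := by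
  funext n y
  cases n with
  | zero => simp [cr]
  | succ n => simp [cr, crTerm]

theorem photonMul_photonMul (u v : (n : ℕ) → (Fin n → R3) → ℝ) (f : Seq) :
    photonMul u (photonMul v f) = photonMul (fun n k => u n k * v n k) f := by
  funext n x
  simp only [photonMul]
  push_cast
  ring

theorem photonMul_add (u : (n : ℕ) → (Fin n → R3) → ℝ) (f g : Seq) :
    photonMul u (f + g) = photonMul u f + photonMul u g := by
  funext n x
  simp [photonMul, mul_add]

theorem photonMul_zero (f : Seq) : photonMul (fun _ _ => 0) f = 0 := by
  funext n x
  simp [photonMul]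

theorem integrand_photonMul (u : (n : ℕ) → (Fin n → R3) → ℝ) (g : Seq) {n : ℕ} (i : Fin (n + 1))
    (x : Config n) (q : R3) :
    integrand n (photonMul u g (n + 1)) i x q
      = (u (n + 1) (i.insertNth (α := fun _ => R3) q x.1) : ℂ) * integrand n (g (n + 1)) i x q := by
  simp only [integrand, photonMul]
  ring

theorem an_photonMul (u : (n : ℕ) → (Fin n → R3) → ℝ) (m : Kernel) (g : Seq) :
    an m (photonMul u g) = an (fun n i k => m n i k * u (n + 1) k) g := by
  funext n x
  simp only [an, integrand_photonMul]
  congr 1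
  refine Finset.sum_congr rfl fun i _ => ?_
  congr 1
  funext q
  push_cast
  ring

theorem photonMul_an (u : (n : ℕ) → (Fin n → R3) → ℝ) (m : Kernel) (g : Seq) :
    photonMul u (an m g) = an (fun n i k => u n (drop i k) * m n i k) g := by
  funext n x
  simp only [an, photonMul]
  rw [mul_left_comm, Finset.mul_sum]
  congr 1
  refine Finset.sum_congr rfl fun i _ => ?_
  rw [← integral_const_mul]
  congr 1
  funext q
  rw [drop_insertNth]
  push_cast
  ring

theorem Aplus_eq (f : Seq) : Aplus f = cr (fun _ _ _ => 1) f := by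
  funext n y
  cases n with
  | zero => rfl
  | succ n =>
    simp only [Aplus, creation, cr, crTerm, Complex.ofReal_one, one_mul]
    rfl

theorem Aminus_eq (g : Seq) : Aminus g = an (fun _ _ _ => 1) g := by
  funext n x
  simp [Aminus, annihilation, an]

/-! ### The weights -/

/-- The indicator function of `T`. -/
def indT (n : ℕ) (k : Fin n → R3) : ℝ := (F n).indicator (fun _ => 1) k

/-- The function `e^{-s p}` cut off to the complement of `T`. -/
def wt (s : ℝ) (n : ℕ) (k : Fin n → R3) : ℝ :=
  (F n)ᶜ.indicator (fun k => Real.exp (-(s * pfun n k))) k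

theorem indT_of_mem {n : ℕ} {k : Fin n → R3} (h : k ∈ F n) : indT n k = 1 :=
  Set.indicator_of_mem h _

theorem indT_of_notMem {n : ℕ} {k : Fin n → R3} (h : k ∉ F n) : indT n k = 0 :=
  Set.indicator_of_notMem h _

theorem wt_of_mem {s : ℝ} {n : ℕ} {k : Fin n → R3} (h : k ∈ F n) : wt s n k = 0 :=
  Set.indicator_of_notMem (by simpa using h) _

theorem wt_of_notMem {s : ℝ} {n : ℕ} {k : Fin n → R3} (h : k ∉ F n) :
    wt s n k = Real.exp (-(s * pfun n k)) :=
  Set.indicator_of_mem h _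

theorem measurable_indT (n : ℕ) : Measurable (indT n) :=
  measurable_const.indicator (measurableSet_F n)

theorem measurable_exp_pfun (s : ℝ) (n : ℕ) :
    Measurable fun k : Fin n → R3 => Real.exp (-(s * pfun n k)) :=
  Real.measurable_exp.comp ((measurable_pfun n).const_mul s).neg

theorem measurable_wt (s : ℝ) (n : ℕ) : Measurable (wt s n) :=
  (measurable_exp_pfun s n).indicator (measurableSet_F n).compl

theorem exp_pfun_le_one {s : ℝ} (hs : 0 ≤ s) {n : ℕ} (k : Fin n → R3) :
    Real.exp (-(s * pfun n k)) ≤ 1 := by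
  rw [Real.exp_le_one_iff, neg_nonpos]
  exact mul_nonneg hs (pfun_pos k).le

theorem abs_indT_le (n : ℕ) (k : Fin n → R3) : |indT n k| ≤ 1 := by
  by_cases h : k ∈ F n
  · simp [indT_of_mem h]
  · simp [indT_of_notMem h]

theorem abs_wt_le {s : ℝ} (hs : 0 ≤ s) (n : ℕ) (k : Fin n → R3) : |wt s n k| ≤ 1 := by
  by_cases h : k ∈ F n
  · simp [wt_of_mem h]
  · rw [wt_of_notMem h, abs_of_pos (Real.exp_pos _)]
    exact exp_pfun_le_one hs k

theorem wt_mul_wt (s t : ℝ) (n : ℕ) (k : Fin n → R3) : wt s n k * wt t n k = wt (s + t) n k := by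
  by_cases h : k ∈ F n
  · simp [wt_of_mem h]
  · rw [wt_of_notMem h, wt_of_notMem h, wt_of_notMem h, ← Real.exp_add]
    ring_nf

theorem wt_mul_exp (s t : ℝ) (n : ℕ) (k : Fin n → R3) :
    wt s n k * Real.exp (-(t * pfun n k)) = wt (s + t) n k := by
  by_cases h : k ∈ F n
  · simp [wt_of_mem h]
  · rw [wt_of_notMem h, wt_of_notMem h, ← Real.exp_add]
    ring_nf

theorem indT_mul_wt (s : ℝ) (n : ℕ) (k : Fin n → R3) : indT n k * wt s n k = 0 := by
  by_cases h : k ∈ F n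
  · simp [wt_of_mem h]
  · simp [indT_of_notMem h]

theorem indT_mul_self (n : ℕ) (k : Fin n → R3) : indT n k * indT n k = indT n k := by
  by_cases h : k ∈ F n
  · simp [indT_of_mem h]
  · simp [indT_of_notMem h]

/-- The kernel form of `1_T A⁺ 1_T = 0`. -/
theorem indT_mul_indT_drop (n : ℕ) (i : Fin (n + 1)) (k : Fin (n + 1) → R3) :
    indT (n + 1) k * indT n (drop i k) = 0 := by
  by_cases h : k ∈ F (n + 1)
  · simp [indT_of_notMem (drop_notMem_F h i)]
  · simp [indT_of_notMem h]

theorem oneT_eq (f : Seq) : oneT f = photonMul indT f := by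
  funext n x
  by_cases h : x.1 ∈ F n
  · simp [oneT, photonMul, indT_of_mem h, h]
  · simp [oneT, photonMul, indT_of_notMem h, h]

theorem oneTc_eq (f : Seq) : oneTc f = photonMul (wt 0) f := by
  funext n x
  by_cases h : x.1 ∈ F n
  · simp [oneTc, photonMul, wt_of_mem h, h]
  · simp [oneTc, photonMul, wt_of_notMem h, h]

/-! ### The bounded operators -/

/-- The kernel `e^{-p/2}`. -/
def dampedKernel : Kernel := fun n _ k => Real.exp (-(1 / 2 * pfun (n + 1) k))

/-- The kernel that cuts off to transitions from outside of `T` into `T`, with weight `e^{-p}`. -/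
def cutKernel : Kernel := fun n i k => indT (n + 1) k * wt 1 n (drop i k)

/-- The kernel for creation of the large photon, with weight `u`. -/
def bigKernel (u : (n : ℕ) → (Fin n → R3) → ℝ) : Kernel := fun n i k =>
  {k | Big n i k}.indicator (fun k => u n (drop i k)) k

/-- The kernel, with weight `u`, for creation of a photon that is not the large one. -/
def smallKernel (u : Kernel) : Kernel := fun n i k =>
  {k | k ∈ F (n + 1) ∧ ¬ Big n i k}.indicator (u n i) k

theorem smallKernel_of_big {u : Kernel} {n : ℕ} {i : Fin (n + 1)} {k : Fin (n + 1) → R3}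
    (h : Big n i k) : smallKernel u n i k = 0 :=
  Set.indicator_of_notMem (fun h' => h'.2 h) _

theorem smallKernel_of_not_big {u : Kernel} {n : ℕ} {i : Fin (n + 1)} {k : Fin (n + 1) → R3}
    (h : ¬ Big n i k) (hF : k ∈ F (n + 1)) : smallKernel u n i k = u n i k :=
  Set.indicator_of_mem (show k ∈ {k | k ∈ F (n + 1) ∧ ¬ Big n i k} from ⟨hF, h⟩) _

theorem smallKernel_of_notMem {u : Kernel} {n : ℕ} {i : Fin (n + 1)} {k : Fin (n + 1) → R3}
    (hF : k ∉ F (n + 1)) : smallKernel u n i k = 0 :=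
  Set.indicator_of_notMem (fun h' => hF h'.1) _

theorem bigKernel_of_big {u : (n : ℕ) → (Fin n → R3) → ℝ} {n : ℕ} {i : Fin (n + 1)}
    {k : Fin (n + 1) → R3} (h : Big n i k) : bigKernel u n i k = u n (drop i k) :=
  Set.indicator_of_mem (show k ∈ {k | Big n i k} from h) _

theorem bigKernel_of_not_big {u : (n : ℕ) → (Fin n → R3) → ℝ} {n : ℕ} {i : Fin (n + 1)}
    {k : Fin (n + 1) → R3} (h : ¬ Big n i k) : bigKernel u n i k = 0 :=
  Set.indicator_of_notMem (show k ∉ {k | Big n i k} from h) _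

theorem Big.mem_F {n : ℕ} {i : Fin (n + 1)} {k : Fin (n + 1) → R3} (h : Big n i k) :
    k ∈ F (n + 1) := (mem_F_succ k).2 ⟨i, h⟩

theorem measurable_bigKernel {u : (n : ℕ) → (Fin n → R3) → ℝ} (hu : ∀ n, Measurable (u n)) (n : ℕ)
    (i : Fin (n + 1)) : Measurable (bigKernel u n i) :=
  ((hu n).comp (measurable_drop i)).indicator (measurableSet_big i)

theorem measurable_smallKernel {u : Kernel} (hu : ∀ n i, Measurable (u n i)) (n : ℕ)
    (i : Fin (n + 1)) : Measurable (smallKernel u n i) :=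
  (hu n i).indicator ((measurableSet_F (n + 1)).inter (measurableSet_big i).compl)

theorem measurable_dampedKernel (n : ℕ) (i : Fin (n + 1)) : Measurable (dampedKernel n i) :=
  measurable_exp_pfun _ _

theorem measurable_cutKernel (n : ℕ) (i : Fin (n + 1)) : Measurable (cutKernel n i) :=
  (measurable_indT (n + 1)).mul ((measurable_wt 1 n).comp (measurable_drop i))

theorem exp_half_sq (p : ℝ) : Real.exp (-(1 / 2 * p)) ^ 2 = Real.exp (-p) := by
  rw [← Real.exp_nat_mul]
  congr 1
  push_cast
  ring

theorem dampedKernel_sq_le (n : ℕ) (i : Fin (n + 1)) (k : Fin (n + 1) → R3) :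
    dampedKernel n i k ^ 2 ≤ Real.exp (-(n + ‖k i‖ ^ 2)) := by
  rw [dampedKernel, exp_half_sq, Real.exp_le_exp, neg_le_neg_iff]
  have := add_sq_le_pfun i k
  push_cast at this
  linarith

theorem boundedMap_damped : BoundedMap (cr dampedKernel) :=
  boundedMap_cr_of_gaussian measurable_dampedKernel dampedKernel_sq_le

/-- A kernel without creation of the large photon has Gaussian decay if it is bounded by
`e^{-p/2}`, where `p` is evaluated without the large photon. -/
theorem smallKernel_sq_le {u : Kernel}
    (hu : ∀ n i j k, Big n j k → i ≠ j →
      u n i k ^ 2 ≤ Real.exp (-(pfun n (drop j k)))) (n : ℕ) (i : Fin (n + 1))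
    (k : Fin (n + 1) → R3) : smallKernel u n i k ^ 2 ≤ Real.exp (-(n + ‖k i‖ ^ 2)) := by
  by_cases hF : k ∈ F (n + 1)
  · by_cases hB : Big n i k
    · rw [smallKernel_of_big hB, zero_pow two_ne_zero]
      exact (Real.exp_pos _).le
    · rw [smallKernel_of_not_big hB hF]
      obtain ⟨j, hj⟩ := (mem_F_succ k).1 hF
      have hij : i ≠ j := fun h => hB (h ▸ hj)
      refine (hu n i j k hj hij).trans ?_
      obtain ⟨l, hl⟩ := exists_drop_eq hij k
      rw [Real.exp_le_exp, neg_le_neg_iff, ← hl]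
      exact add_sq_le_pfun l _
  · rw [smallKernel_of_notMem hF, zero_pow two_ne_zero]
    exact (Real.exp_pos _).le

/-- The kernel `e^{-p/2}`, with `p` evaluated without the created photon. -/
def weightKernel : Kernel := fun n i k => Real.exp (-(1 / 2 * pfun n (drop i k)))

/-- If `j` is the large photon, then `p` without `i` dominates `p` without `j`, and the latter still
contains the created photon `i`. -/
theorem smallKernel_weight_sq_le (n : ℕ) (i : Fin (n + 1)) (k : Fin (n + 1) → R3) :
    smallKernel weightKernel n i k ^ 2 ≤ Real.exp (-(n + ‖k i‖ ^ 2)) := by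
  refine smallKernel_sq_le (fun n i j k hj hij => ?_) n i k
  rw [weightKernel, exp_half_sq, Real.exp_le_exp, neg_le_neg_iff]
  exact hj.pfun_le hij.symm

theorem measurable_smallKernel_weight (n : ℕ) (i : Fin (n + 1)) :
    Measurable (smallKernel weightKernel n i) :=
  measurable_smallKernel (fun n i => (measurable_exp_pfun _ n).comp (measurable_drop i)) n i

theorem boundedMap_small_weight : BoundedMap (cr (smallKernel weightKernel)) :=
  boundedMap_cr_of_gaussian measurable_smallKernel_weight smallKernel_weight_sq_le

/-- The function `e^{-p/2}` on `T`, with `p` evaluated without the large photon. -/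
def bigWeight : (n : ℕ) → (Fin n → R3) → ℝ
  | 0, _ => 0
  | n + 1, k => ∑ j, bigKernel (fun n k => Real.exp (-(1 / 2 * pfun n k))) n j k

theorem bigWeight_of_big {n : ℕ} {j : Fin (n + 1)} {k : Fin (n + 1) → R3} (h : Big n j k) :
    bigWeight (n + 1) k = Real.exp (-(1 / 2 * pfun n (drop j k))) := by
  rw [bigWeight, Finset.sum_eq_single j, bigKernel_of_big h]
  · exact fun l _ hl => bigKernel_of_not_big fun h' => hl (h'.unique h)
  · simp

theorem measurable_bigWeight : ∀ n, Measurable (bigWeight n)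
  | 0 => measurable_const
  | n + 1 => Finset.measurable_fun_sum _ fun j _ =>
      measurable_bigKernel (fun n => measurable_exp_pfun (1 / 2) n) n j

theorem bigWeight_of_notMem {n : ℕ} {k : Fin n → R3} (h : k ∉ F n) : bigWeight n k = 0 := by
  obtain _ | n := n
  · rfl
  · exact Finset.sum_eq_zero fun j _ => bigKernel_of_not_big fun h' => h h'.mem_F

theorem abs_bigWeight_le (n : ℕ) (k : Fin n → R3) : |bigWeight n k| ≤ 1 := by
  by_cases h : k ∈ F n
  · obtain _ | n := n
    · simp [bigWeight]
    · obtain ⟨j, hj⟩ := (mem_F_succ k).1 h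
      rw [bigWeight_of_big hj, abs_of_pos (Real.exp_pos _)]
      exact exp_pfun_le_one (by norm_num) _
  · simp [bigWeight_of_notMem h]

/-- Here the damping acts after creation and depends only on the photons other than the large one.
No decay of the input is required, which is what starts the bootstrap for vectors in `V`. -/
theorem boundedMap_small_bigWeight :
    BoundedMap (cr (smallKernel fun n _ k => bigWeight (n + 1) k)) := by
  refine boundedMap_cr_of_gaussian
    (measurable_smallKernel fun n _ => measurable_bigWeight (n + 1))
    (smallKernel_sq_le fun n i j k hj _ => ?_)
  rw [bigWeight_of_big hj, exp_half_sq]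

/-! ### Creation of the large photon and the bounded cut kernel -/

/-- The shell integral, cut off to the configurations from which the large photon is created. -/
def cutShellInt (n : ℕ) (k : Fin n → R3) : ℝ≥0∞ :=
  {k | 1 ≤ n ∧ k ∉ F n}.indicator shellInt k

theorem shell_bigKernel (u : (n : ℕ) → (Fin n → R3) → ℝ) (n : ℕ) (i : Fin (n + 1))
    (k : Fin n → R3) : shell (bigKernel u) n i k = ‖u n k‖ₑ ^ 2 * cutShellInt n k := by
  by_cases hk : k ∈ {k : Fin n → R3 | 1 ≤ n ∧ k ∉ F n}
  · rw [cutShellInt, Set.indicator_of_mem hk, shellInt,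
      ← lintegral_const_mul' _ _ (by finiteness), ← lintegral_indicator]
    · refine lintegral_congr fun q => ?_
      by_cases hq : q ∈ {q : R3 | Real.exp (pfun n k / 2) < ‖q‖ ∧ ‖q‖ < Real.exp (pfun n k)}
      · rw [Set.indicator_of_mem hq, bigKernel_of_big ((big_insertNth i q k).2 ⟨hk, hq⟩),
          drop_insertNth]
      · rw [Set.indicator_of_notMem hq,
          bigKernel_of_not_big fun h => hq ((big_insertNth i q k).1 h).2]
        simp
    · exact (measurableSet_lt measurable_const measurable_norm).inter
        (measurableSet_lt measurable_norm measurable_const)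
  · rw [cutShellInt, Set.indicator_of_notMem hk, mul_zero, shell]
    have : ∀ q : R3, ‖bigKernel u n i (i.insertNth (α := fun _ => R3) q k)‖ₑ ^ 2
        * ‖formFactor q‖ₑ ^ 2 = 0 := fun q => by
      rw [bigKernel_of_not_big fun h => hk ((big_insertNth i q k).1 h).1]
      simp
    rw [lintegral_congr this, lintegral_zero]

/-- The large photon is unique, so there are no cross terms, and the `n + 1` equal contributions
cancel the factor `1/(n + 1)`. The equality serves for upper and lower bounds. -/
theorem lintegral_cr_bigKernel {u : (n : ℕ) → (Fin n → R3) → ℝ} (hu : ∀ n, Measurable (u n))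
    {f : Seq} (hf : Meas f) (n : ℕ) :
    ∫⁻ y, ‖cr (bigKernel u) f (n + 1) y‖ₑ ^ 2
      = ∫⁻ x : Config n, ‖f n x‖ₑ ^ 2 * (‖u n x.1‖ₑ ^ 2 * cutShellInt n x.1) := by
  rw [lintegral_cr_of_unique (measurable_bigKernel hu) (fun n k i j hi hj => ?_) hf]
  · simp only [shell_bigKernel]
    exact sum_fin_const_mul _
  · by_contra hij
    by_cases h : Big n i k
    · exact hj (bigKernel_of_not_big fun h' => hij (h.unique h'))
    · exact hi (bigKernel_of_not_big h)

theorem enorm_sq_real (r : ℝ) : ‖r‖ₑ ^ 2 = ENNReal.ofReal (r ^ 2) := by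
  rw [← ofReal_norm, ← ENNReal.ofReal_pow (norm_nonneg _), Real.norm_eq_abs, sq_abs]

theorem wt_sq_mul_cutShellInt_le (n : ℕ) (k : Fin n → R3) :
    ‖wt 1 n k‖ₑ ^ 2 * cutShellInt n k ≤ ENNReal.ofReal halfArea := by
  by_cases h : k ∈ F n
  · simp [wt_of_mem h]
  · have h1 : cutShellInt n k ≤ shellInt k := Set.indicator_le_self _ _ _
    refine (mul_le_mul_right (h1.trans (shellInt_le k)) _).trans (le_of_eq ?_)
    rw [wt_of_notMem h, enorm_sq_real, ← ENNReal.ofReal_mul (sq_nonneg _), ← Real.exp_nat_mul,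
      mul_left_comm, ← Real.exp_add]
    push_cast
    ring_nf
    simp

theorem boundedMap_big_wt : BoundedMap (cr (bigKernel (wt 1))) := by
  refine boundedMap_cr (measurable_bigKernel (measurable_wt 1)) halfArea.toNNReal
    fun f hf n => ?_
  rw [lintegral_cr_bigKernel (measurable_wt 1) hf, ← lintegral_const_mul' _ _ (by finiteness)]
  refine lintegral_mono fun x => ?_
  simp only
  rw [mul_comm]
  exact mul_le_mul_left (wt_sq_mul_cutShellInt_le n x.1) _

/-- The created photon is either large or not. In the second case one factor `e^{-p/2}` ensures
boundedness and the other is kept on the right, so that this part can be treated as a perturbation.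
-/
theorem cutKernel_eq (n : ℕ) (i : Fin (n + 1)) (k : Fin (n + 1) → R3) :
    cutKernel n i k
      = bigKernel (wt 1) n i k + smallKernel weightKernel n i k * wt (1 / 2) n (drop i k) := by
  by_cases hF : k ∈ F (n + 1)
  · by_cases hB : Big n i k
    · rw [smallKernel_of_big hB, bigKernel_of_big hB, cutKernel, indT_of_mem hF]
      ring
    · rw [smallKernel_of_not_big hB hF, bigKernel_of_not_big hB, cutKernel, indT_of_mem hF,
        weightKernel, mul_comm (Real.exp _), wt_mul_exp]
      norm_num
  · rw [smallKernel_of_notMem hF, bigKernel_of_not_big fun h => hF h.mem_F, cutKernel,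
      indT_of_notMem hF]
    ring

theorem cr_cutKernel (f : Seq) : cr cutKernel f
    = cr (bigKernel (wt 1)) f + cr (smallKernel weightKernel) (photonMul (wt (1 / 2)) f) := by
  rw [cr_photonMul, ← cr_add_kernel]
  congr 1
  funext n i k
  exact cutKernel_eq n i k

theorem boundedMap_indT : BoundedMap (photonMul indT) :=
  boundedMap_photonMul measurable_indT abs_indT_le

theorem boundedMap_wt {s : ℝ} (hs : 0 ≤ s) : BoundedMap (photonMul (wt s)) :=
  boundedMap_photonMul (measurable_wt s) (abs_wt_le hs)

theorem boundedMap_cut : BoundedMap (cr cutKernel) := by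
  have h := boundedMap_big_wt.sum
    (boundedMap_small_weight.comp (boundedMap_wt (s := 1 / 2) (by norm_num)))
  have e : cr cutKernel = fun f => cr (bigKernel (wt 1)) f
      + cr (smallKernel weightKernel) (photonMul (wt (1 / 2)) f) := funext cr_cutKernel
  rw [e]
  exact h

theorem shell_cutKernel_le (n : ℕ) (i : Fin (n + 1)) (k : Fin n → R3) :
    shell cutKernel n i k ≤ ENNReal.ofReal halfArea + gaussBound := by
  have h1 : shell cutKernel n i k
      ≤ shell (bigKernel (wt 1)) n i k + shell (smallKernel weightKernel) n i k := by
    unfold shell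
    rw [← lintegral_add_left]
    · refine lintegral_mono fun q => ?_
      simp only
      rw [← add_mul]
      refine mul_le_mul_left ?_ _
      rw [cutKernel_eq]
      set k' := i.insertNth (α := fun _ => R3) q k
      -- The two kernels have disjoint supports, so their squares add.
      by_cases hB : Big n i k'
      · simp [smallKernel_of_big hB]
      · rw [bigKernel_of_not_big hB]
        simp only [zero_add, enorm_zero, ne_eq, OfNat.ofNat_ne_zero, not_false_eq_true, zero_pow]
        rw [enorm_mul, mul_pow]
        refine mul_le_of_le_one_right zero_le (pow_le_one₀ zero_le ?_)
        rw [← ofReal_norm, ENNReal.ofReal_le_one]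
        exact abs_wt_le (by norm_num) n _
    · have h2 : Measurable fun q : R3 =>
          bigKernel (wt 1) n i (i.insertNth (α := fun _ => R3) q k) :=
        (measurable_bigKernel (measurable_wt 1) n i).comp
          ((measurable_insertNth i).comp (measurable_const.prodMk measurable_id))
      exact (h2.enorm.pow_const 2).mul (measurable_formFactor.enorm.pow_const 2)
  refine h1.trans (add_le_add ?_ ?_)
  · rw [shell_bigKernel]
    exact wt_sq_mul_cutShellInt_le n k
  · exact shell_le_gaussBound (smallKernel_weight_sq_le n i) k

/-! ### Lower bounds -/

/-- The exponential weight `e^{s p}`. -/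
def expWeight (s : ℝ) (n : ℕ) (k : Fin n → R3) : ℝ := Real.exp (s * pfun n k)

theorem measurable_expWeight (s : ℝ) (n : ℕ) : Measurable (expWeight s n) :=
  Real.measurable_exp.comp ((measurable_pfun n).const_mul s)

theorem pfun_zero (k : Fin 0 → R3) : pfun 0 k = Real.exp 1 := by
  simp [pfun]

/-- Off `F` and with at least one photon, creation of the large photon multiplies the squared
density by the shell integral, at least a constant times `e^{2p}`. The vacuum component has no large
photon to create, but `p` is constant there. -/
theorem exists_lower_bound : ∃ C : NNReal, ∀ (u : (n : ℕ) → (Fin n → R3) → ℝ),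
    (∀ n, Measurable (u n)) → ∀ f : Seq, Meas f → (∀ n x, x.1 ∈ F n → f n x = 0) →
    sqNorm (photonMul (expWeight 1) (photonMul u f))
      ≤ C * (sqNorm (photonMul u f) + sqNorm (cr (bigKernel u) f)) := by
  -- The first constant is `e^{2p}` for `n = 0`, where `p = e`; the second inverts the lower bound
  -- of `le_shellInt`.
  refine ⟨Real.toNNReal (Real.exp 1).exp ^ 2 + Real.toNNReal (2 / halfArea),
    fun u hu f hf hF => ?_⟩
  have hz : ∀ g : Seq, sqNorm g = (∫⁻ x, ‖g 0 x‖ₑ ^ 2) + ∑' n, ∫⁻ x, ‖g (n + 1) x‖ₑ ^ 2 :=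
    fun g => tsum_eq_zero_add' ENNReal.summable
  have h0 : ∫⁻ x, ‖photonMul (expWeight 1) (photonMul u f) 0 x‖ₑ ^ 2
      = (Real.toNNReal (Real.exp 1).exp ^ 2 : NNReal) * ∫⁻ x, ‖photonMul u f 0 x‖ₑ ^ 2 := by
    rw [← lintegral_const_mul' _ _ (by finiteness)]
    refine lintegral_congr fun x => ?_
    have e : photonMul (expWeight 1) (photonMul u f) 0 x
        = ((Real.exp (Real.exp 1) : ℝ) : ℂ) * photonMul u f 0 x := by
      rw [photonMul, expWeight, pfun_zero, one_mul]
    rw [e, enorm_mul, mul_pow]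
    congr 1
    rw [enorm_sq_ofReal, Complex.norm_real, Real.norm_eq_abs, sq_abs, ENNReal.coe_pow,
      ENNReal.ofReal_pow (Real.exp_pos _).le]
    rfl
  have h1 : ∀ n, ∫⁻ x, ‖photonMul (expWeight 1) (photonMul u f) (n + 1) x‖ₑ ^ 2
      ≤ (Real.toNNReal (2 / halfArea) : NNReal) *
        ∫⁻ y, ‖cr (bigKernel u) f (n + 1 + 1) y‖ₑ ^ 2 := fun n => by
    rw [lintegral_cr_bigKernel hu hf, ← lintegral_const_mul' _ _ (by finiteness)]
    refine lintegral_mono fun x => ?_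
    simp only
    by_cases hx : x.1 ∈ F (n + 1)
    · simp [photonMul, hF _ _ hx]
    · have hx' : x.1 ∈ {k : Fin (n + 1) → R3 | 1 ≤ n + 1 ∧ k ∉ F (n + 1)} := ⟨by omega, hx⟩
      rw [cutShellInt, Set.indicator_of_mem hx']
      have h2 : ENNReal.ofReal (Real.exp (2 * pfun (n + 1) x.1))
          ≤ (Real.toNNReal (2 / halfArea) : NNReal) * shellInt x.1 := by
        refine le_trans (le_of_eq ?_) (mul_le_mul_right (le_shellInt x.1) _)
        change _ = ENNReal.ofReal _ * _
        have := halfArea_pos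
        rw [← ENNReal.ofReal_mul (by positivity)]
        congr 1
        field_simp
      calc _ = ENNReal.ofReal (Real.exp (2 * pfun (n + 1) x.1)) *
            (‖f (n + 1) x‖ₑ ^ 2 * ‖u (n + 1) x.1‖ₑ ^ 2) := by
            simp only [photonMul, expWeight, one_mul]
            rw [enorm_mul, enorm_mul, mul_pow, mul_pow, enorm_sq_ofReal ((Real.exp _ : ℝ) : ℂ),
              Complex.norm_real, Real.norm_eq_abs, sq_abs, ← Real.exp_nat_mul,
              enorm_sq_ofReal ((u (n + 1) x.1 : ℝ) : ℂ), Complex.norm_real, Real.norm_eq_abs,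
              sq_abs, enorm_sq_real]
            push_cast
            ring
        _ ≤ _ := by
            refine (mul_le_mul_left h2 _).trans (le_of_eq ?_)
            ring
  rw [hz, h0, hz (photonMul u f), hz (cr (bigKernel u) f)]
  have h2 : ∑' n, ∫⁻ x, ‖photonMul (expWeight 1) (photonMul u f) (n + 1) x‖ₑ ^ 2
      ≤ (Real.toNNReal (2 / halfArea) : NNReal) *
        ∑' n, ∫⁻ y, ‖cr (bigKernel u) f (n + 1) y‖ₑ ^ 2 := by
    rw [← ENNReal.tsum_mul_left]
    refine (ENNReal.tsum_le_tsum h1).trans ?_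
    exact ENNReal.tsum_comp_le_tsum_of_injective (add_left_injective 1) fun n =>
      (Real.toNNReal (2 / halfArea) : NNReal) * ∫⁻ y, ‖cr (bigKernel u) f (n + 1) y‖ₑ ^ 2
  rw [ENNReal.coe_add]
  set X := ∫⁻ x, ‖photonMul u f 0 x‖ₑ ^ 2
  set Y := ∑' n, ∫⁻ y, ‖cr (bigKernel u) f (n + 1) y‖ₑ ^ 2
  refine (add_le_add le_rfl h2).trans ?_
  rw [add_mul]
  refine add_le_add (mul_le_mul_right ?_ _) (mul_le_mul_right ?_ _)
  · exact (le_self_add).trans le_self_add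
  · exact le_add_self.trans le_add_self

/-! ### Operators on the Hilbert space -/

/-- The projection onto `T`. -/
def opP : Fock →L[ℂ] Fock := boundedMap_indT.toCLM

/-- Multiplication by `e^{-p}` on the complement of `T`. -/
def opR : Fock →L[ℂ] Fock := (boundedMap_wt zero_le_one).toCLM

/-- Multiplication by `e^{-p/2}` on the complement of `T`. -/
def opRhalf : Fock →L[ℂ] Fock := (boundedMap_wt one_half_pos.le).toCLM

/-- The damped creation operator `e^{-p/2} A⁺`. -/
def opZ : Fock →L[ℂ] Fock := boundedMap_damped.toCLM

/-- The creation operator from the complement of `T` into `T`, with weight `e^{-p}`. -/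
def opK : Fock →L[ℂ] Fock := boundedMap_cut.toCLM

/-- The weighted operator `1_T A e^{-p} 1_{Tᶜ}`. -/
def opG : Fock →L[ℂ] Fock := opK + opP ∘L opZ.adjoint ∘L opRhalf

/-- The weighted operator `e^{-p} 1_{Tᶜ} A⁺ 1_{Tᶜ} e^{-p}`. -/
def opM : Fock →L[ℂ] Fock := opRhalf ∘L opZ ∘L opR

/-- The weighted operator `e^{-p} 1_{Tᶜ} A 1_{Tᶜ} e^{-p}`. -/
def opN : Fock →L[ℂ] Fock := opM + opM.adjoint

theorem rep_opP (ψ : Fock) : SeqEq (rep (opP ψ)) (photonMul indT (rep ψ)) :=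
  boundedMap_indT.rep_toCLM ψ

theorem rep_opR (ψ : Fock) : SeqEq (rep (opR ψ)) (photonMul (wt 1) (rep ψ)) :=
  (boundedMap_wt zero_le_one).rep_toCLM ψ

theorem rep_opRhalf (ψ : Fock) : SeqEq (rep (opRhalf ψ)) (photonMul (wt (1 / 2)) (rep ψ)) :=
  (boundedMap_wt one_half_pos.le).rep_toCLM ψ

theorem rep_opZ (ψ : Fock) : SeqEq (rep (opZ ψ)) (cr dampedKernel (rep ψ)) :=
  boundedMap_damped.rep_toCLM ψ

theorem rep_opK (ψ : Fock) : SeqEq (rep (opK ψ)) (cr cutKernel (rep ψ)) :=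
  boundedMap_cut.rep_toCLM ψ

theorem inner_opP (ψ φ : Fock) : inner ℂ (opP ψ) φ = inner ℂ ψ (opP φ) :=
  inner_photonMul rep_opP ψ φ

theorem inner_opR (ψ φ : Fock) : inner ℂ (opR ψ) φ = inner ℂ ψ (opR φ) :=
  inner_photonMul rep_opR ψ φ

theorem inner_opRhalf (ψ φ : Fock) : inner ℂ (opRhalf ψ) φ = inner ℂ ψ (opRhalf φ) :=
  inner_photonMul rep_opRhalf ψ φ

theorem inner_opN (ψ φ : Fock) : inner ℂ (opN ψ) φ = inner ℂ ψ (opN φ) := by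
  simp only [opN, add_apply, inner_add_left, inner_add_right,
    ContinuousLinearMap.adjoint_inner_left, ContinuousLinearMap.adjoint_inner_right]
  ring

/-! ### Relations between the block operators -/

theorem SeqEq.of_eq {f g : Seq} (h : f = g) : SeqEq f g := fun n => by rw [h]

theorem eq_zero_of_rep {ψ : Fock} (h : SeqEq (rep ψ) 0) : ψ = 0 :=
  ext_rep (h.trans rep_zero.symm)

theorem opP_opP (ψ : Fock) : opP (opP ψ) = opP ψ := by
  refine ext_rep ((rep_opP _).trans ((photonMul_congr indT (rep_opP ψ)).trans ?_))
  rw [photonMul_photonMul]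
  simp only [indT_mul_self]
  exact (rep_opP ψ).symm

theorem opP_opR (ψ : Fock) : opP (opR ψ) = 0 := by
  refine eq_zero_of_rep ((rep_opP _).trans ((photonMul_congr indT (rep_opR ψ)).trans ?_))
  rw [photonMul_photonMul]
  simp only [indT_mul_wt, photonMul_zero]
  exact SeqEq.rfl'

theorem opP_opRhalf (ψ : Fock) : opP (opRhalf ψ) = 0 := by
  refine eq_zero_of_rep ((rep_opP _).trans ((photonMul_congr indT (rep_opRhalf ψ)).trans ?_))
  rw [photonMul_photonMul]
  simp only [indT_mul_wt, photonMul_zero]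
  exact SeqEq.rfl'

theorem opRhalf_opP (ψ : Fock) : opRhalf (opP ψ) = 0 := by
  rw [← inner_self_eq_zero (𝕜 := ℂ), inner_opRhalf, inner_opP, opP_opRhalf, inner_zero_right]

theorem opRhalf_opRhalf (ψ : Fock) : opRhalf (opRhalf ψ) = opR ψ := by
  refine ext_rep ((rep_opRhalf _).trans ((photonMul_congr _ (rep_opRhalf ψ)).trans ?_))
  rw [photonMul_photonMul]
  simp only [wt_mul_wt, add_halves]
  exact (rep_opR ψ).symm

theorem opP_opK (ψ : Fock) : opP (opK ψ) = opK ψ := by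
  refine ext_rep ((rep_opP _).trans ((photonMul_congr indT (rep_opK ψ)).trans ?_))
  rw [photonMul_cr]
  simp only [cutKernel, ← mul_assoc, indT_mul_self]
  exact (rep_opK ψ).symm

theorem opK_opP (ψ : Fock) : opK (opP ψ) = 0 := by
  refine eq_zero_of_rep ((rep_opK _).trans ((cr_congr _ (rep_opP ψ)).trans ?_))
  rw [cr_photonMul]
  simp only [cutKernel, mul_assoc, mul_comm (wt _ _ _), indT_mul_wt, mul_zero, cr_zero_kernel]
  exact SeqEq.rfl'

theorem opG_apply (ψ : Fock) : opG ψ = opK ψ + opP (opZ.adjoint (opRhalf ψ)) := rfl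

theorem opG_opP (ψ : Fock) : opG (opP ψ) = 0 := by
  rw [opG_apply, opK_opP, opRhalf_opP, map_zero, map_zero, add_zero]

theorem opP_opG (ψ : Fock) : opP (opG ψ) = opG ψ := by
  rw [opG_apply, map_add, opP_opK, opP_opP]

theorem adjoint_opG (ψ : Fock) : opG.adjoint ψ = opK.adjoint ψ + opRhalf (opZ (opP ψ)) := by
  refine ext_inner_right ℂ fun φ => ?_
  rw [ContinuousLinearMap.adjoint_inner_left, opG_apply, inner_add_right, inner_add_left,
    ContinuousLinearMap.adjoint_inner_left, ← inner_opP, ContinuousLinearMap.adjoint_inner_right,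
    ← inner_opRhalf]

theorem opN_apply (ψ : Fock) :
    opN ψ = opRhalf (opZ (opR ψ)) + opR (opZ.adjoint (opRhalf ψ)) := by
  refine ext_inner_right ℂ fun φ => ?_
  simp only [opN, opM, add_apply, ContinuousLinearMap.comp_apply,
    inner_add_left, ContinuousLinearMap.adjoint_inner_left]
  rw [inner_opR, ContinuousLinearMap.adjoint_inner_left, inner_opRhalf ψ]

theorem opP_opN (ψ : Fock) : opP (opN ψ) = 0 := by
  rw [opN_apply, map_add, opP_opRhalf, opP_opR, add_zero]

theorem rep_opZ_adjoint (ψ : Fock) : SeqEq (rep (opZ.adjoint ψ)) (an dampedKernel (rep ψ)) :=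
  rep_adjoint_cr measurable_dampedKernel ENNReal.coe_ne_top
    (fun n i => shell_le_gaussBound (dampedKernel_sq_le n i)) boundedMap_damped ψ

theorem rep_opK_adjoint (ψ : Fock) : SeqEq (rep (opK.adjoint ψ)) (an cutKernel (rep ψ)) :=
  rep_adjoint_cr measurable_cutKernel (C := ENNReal.ofReal halfArea + gaussBound) (by finiteness)
    shell_cutKernel_le boundedMap_cut ψ

/-! ### The formal operator on the domain -/

theorem integrable_damped (ψ : Fock) (n : ℕ) (i : Fin (n + 1)) : ∀ᵐ x : Config n,
    Integrable fun q : R3 => (dampedKernel n i (i.insertNth (α := fun _ => R3) q x.1) : ℂ)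
      * integrand n (rep ψ (n + 1)) i x q :=
  an_absConv measurable_dampedKernel ENNReal.coe_ne_top
    (fun n i => shell_le_gaussBound (dampedKernel_sq_le n i)) ψ n i

theorem integrable_cut (ψ : Fock) (n : ℕ) (i : Fin (n + 1)) : ∀ᵐ x : Config n,
    Integrable fun q : R3 => (cutKernel n i (i.insertNth (α := fun _ => R3) q x.1) : ℂ)
      * integrand n (rep ψ (n + 1)) i x q :=
  an_absConv measurable_cutKernel (C := ENNReal.ofReal halfArea + gaussBound) (by finiteness)
    shell_cutKernel_le ψ n i

theorem integrand_indT_of_mem (ψ : Fock) {n : ℕ} (i : Fin (n + 1)) {x : Config n}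
    (hx : x.1 ∈ F n) (q : R3) : integrand n (photonMul indT (rep ψ) (n + 1)) i x q = 0 := by
  rw [integrand_photonMul, indT_of_notMem (insertNth_notMem_F hx i q)]
  simp

/-- No decay of `ψ` on `T` is available. Outside `F`, the weight in `cutKernel` depends only on the
remaining photons and can be divided out of a convergent integral; inside `F`, the integrand
vanishes. -/
theorem absConv_indT (ψ : Fock) : AbsConv (photonMul indT (rep ψ)) := by
  intro n i
  filter_upwards [integrable_cut ψ n i] with x hx
  by_cases h : x.1 ∈ F n
  · exact (integrable_zero R3 ℂ volume).congr
      (Filter.Eventually.of_forall fun q => (integrand_indT_of_mem ψ i h q).symm)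
  · have hne : ((wt 1 n x.1 : ℝ) : ℂ) ≠ 0 := by
      rw [wt_of_notMem h]
      exact_mod_cast (Real.exp_pos _).ne'
    refine (hx.const_mul (((wt 1 n x.1 : ℝ) : ℂ)⁻¹)).congr
      (Filter.Eventually.of_forall fun q => ?_)
    simp only [cutKernel, drop_insertNth, integrand_photonMul]
    push_cast
    field_simp

/-- The weight `e^{-p}` is split in two halves: one damps the annihilation kernel, the other leaves
a vector of the Hilbert space. -/
theorem photonMul_wt_eq (x : Fock) :
    SeqEq (photonMul (expWeight (-(1 / 2))) (rep (opRhalf x))) (photonMul (wt 1) (rep x)) := by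
  refine (photonMul_congr _ (rep_opRhalf x)).trans (SeqEq.of_eq ?_)
  rw [photonMul_photonMul]
  congr 1
  funext n k
  rw [expWeight, mul_comm, neg_mul, wt_mul_exp]
  norm_num

theorem absConv_wt (x : Fock) : AbsConv (photonMul (wt 1) (rep x)) := by
  refine AbsConv.congr (photonMul_wt_eq x) fun n i => ?_
  filter_upwards [integrable_damped (opRhalf x) n i] with y hy
  refine hy.congr (Filter.Eventually.of_forall fun q => ?_)
  simp only [integrand_photonMul, dampedKernel, expWeight, neg_mul]

theorem Aminus_wt (x : Fock) :
    SeqEq (Aminus (photonMul (wt 1) (rep x))) (rep (opZ.adjoint (opRhalf x))) := by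
  refine SeqEq.trans (fun n => annihilation_congr ((photonMul_wt_eq x).symm (n + 1))) ?_
  refine SeqEq.trans (SeqEq.of_eq ?_) (rep_opZ_adjoint (opRhalf x)).symm
  change Aminus (photonMul (expWeight (-(1 / 2))) (rep (opRhalf x))) = _
  rw [Aminus_eq, an_photonMul]
  congr 1
  funext n i k
  simp only [dampedKernel, expWeight, neg_mul, one_mul]

theorem wt_Aplus (x : Fock) :
    SeqEq (photonMul (wt 1) (Aplus (rep x))) (rep (opRhalf (opZ x))) := by
  refine SeqEq.trans (SeqEq.of_eq ?_)
    ((rep_opRhalf _).trans (photonMul_congr _ (rep_opZ x))).symm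
  rw [Aplus_eq, photonMul_cr, photonMul_cr]
  congr 1
  funext n i k
  rw [dampedKernel, wt_mul_exp]
  norm_num

variable {ψ x : Fock}

theorem rep_decomp (h : ψ - opP ψ = opR x) :
    SeqEq (rep ψ) (photonMul indT (rep ψ) + photonMul (wt 1) (rep x)) := by
  have h1 : ψ = opP ψ + opR x := by rw [← h]; abel
  have h2 : SeqEq (rep ψ) (rep (opP ψ + opR x)) := SeqEq.of_eq (congrArg rep h1)
  exact h2.trans ((rep_add _ _).trans ((rep_opP ψ).add (rep_opR x)))

theorem absConv_of_decomp (h : ψ - opP ψ = opR x) : AbsConv (rep ψ) :=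
  ((absConv_indT ψ).add (absConv_wt x)).congr (rep_decomp h).symm

theorem A_decomp (h : ψ - opP ψ = opR x) :
    SeqEq (A (rep ψ)) ((Aplus (photonMul indT (rep ψ)) + Aminus (photonMul indT (rep ψ)))
      + (Aplus (photonMul (wt 1) (rep x)) + Aminus (photonMul (wt 1) (rep x)))) :=
  (A_congr (rep_decomp h)).trans (A_add (absConv_indT ψ) (absConv_wt x))

theorem indT_Aplus_wt (x : Fock) :
    SeqEq (photonMul indT (Aplus (photonMul (wt 1) (rep x)))) (rep (opK x)) := by
  refine SeqEq.trans (SeqEq.of_eq ?_) (rep_opK x).symm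
  rw [Aplus_eq, photonMul_cr, cr_photonMul]
  simp only [mul_one]
  rfl

theorem oneT_A_of_decomp (h : ψ - opP ψ = opR x) : SeqEq (oneT (A (rep ψ))) (rep (opG x)) := by
  rw [oneT_eq]
  refine (photonMul_congr indT (A_decomp h)).trans ?_
  rw [photonMul_add, photonMul_add, photonMul_add]
  have h1 : photonMul indT (Aplus (photonMul indT (rep ψ))) = 0 := by
    rw [Aplus_eq, photonMul_cr, cr_photonMul]
    simp only [mul_one, indT_mul_indT_drop, cr_zero_kernel]
  -- Inserting a photon into a configuration in `F` leads out of `F`, so the integrands vanish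
  -- identically there.
  have h2 : photonMul indT (Aminus (photonMul indT (rep ψ))) = 0 := by
    funext n y
    by_cases hy : y.1 ∈ F n
    · simp [photonMul, Aminus, annihilation, integrand_indT_of_mem ψ _ hy]
    · simp [photonMul, indT_of_notMem hy]
  rw [h1, h2, add_zero, zero_add, opG_apply]
  refine SeqEq.trans ?_ (rep_add _ _).symm
  exact (indT_Aplus_wt x).add ((photonMul_congr _ (Aminus_wt x)).trans (rep_opP _).symm)

/-- Annihilation and creation acting on the `T` part of `ψ` give the two summands of `G† ψ`; acting
on `e^{-p} x` they give those of `N x`. -/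
theorem wt_A_of_decomp (h : ψ - opP ψ = opR x) :
    SeqEq (photonMul (wt 1) (A (rep ψ))) (rep (opG.adjoint ψ + opN x)) := by
  refine (photonMul_congr _ (A_decomp h)).trans ?_
  rw [photonMul_add, photonMul_add, photonMul_add, adjoint_opG, opN_apply]
  refine SeqEq.trans ?_ (rep_add _ _).symm
  refine SeqEq.add ?_ ?_
  · refine SeqEq.trans ?_ (rep_add _ _).symm
    rw [add_comm]
    refine SeqEq.add ?_ ?_
    · refine SeqEq.trans (SeqEq.of_eq ?_) (rep_opK_adjoint ψ).symm
      rw [Aminus_eq, photonMul_an, an_photonMul]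
      congr 1
      funext n i k
      rw [cutKernel]
      ring
    · exact (photonMul_congr _ (Aplus_congr (rep_opP ψ).symm)).trans (wt_Aplus _)
  · refine SeqEq.trans ?_ (rep_add _ _).symm
    refine SeqEq.add ?_ ?_
    · exact (photonMul_congr _ (Aplus_congr (rep_opR x).symm)).trans (wt_Aplus _)
    · exact (photonMul_congr _ (Aminus_wt x)).trans (rep_opR _).symm

/-- On such vectors `1_T A⁺ 1_{Tᶜ} ψ` is the bounded operator `opK` applied to `x`. -/
theorem mem_V_of_decomp (h : ψ - opP ψ = opR x) : ψ ∈ V := by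
  refine FiniteNorm.congr (SeqEq.symm ?_) (rep_finiteNorm (opK x))
  refine SeqEq.trans ?_ (indT_Aplus_wt x)
  rw [oneT_eq]
  refine photonMul_congr _ (Aplus_congr ?_)
  rw [oneTc_eq]
  refine (photonMul_congr _ (rep_decomp h)).trans (SeqEq.of_eq ?_)
  rw [photonMul_add, photonMul_photonMul, photonMul_photonMul]
  simp only [mul_comm (wt _ _ _) (indT _ _), indT_mul_wt, photonMul_zero, wt_mul_wt, zero_add]

/-! ### Decay of the vectors in the domain -/

theorem finiteNorm_expWeight {u : (n : ℕ) → (Fin n → R3) → ℝ} (hu : ∀ n, Measurable (u n))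
    {f : Seq} (hF : ∀ n x, x.1 ∈ F n → f n x = 0) (hf : Meas f) (h1 : FiniteNorm (photonMul u f))
    (h2 : FiniteNorm (cr (bigKernel u) f)) :
    FiniteNorm (photonMul (expWeight 1) (photonMul u f)) := by
  rw [finiteNorm_iff] at h1 h2 ⊢
  obtain ⟨C, hC⟩ := exists_lower_bound
  refine ⟨photonMul_meas (measurable_expWeight 1) h1.1, ne_top_of_le_ne_top ?_ (hC u hu f hf hF)⟩
  exact ENNReal.mul_ne_top ENNReal.coe_ne_top (ENNReal.add_ne_top.2 ⟨h1.2, h2.2⟩)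

theorem indT_Aplus_eq (f : Seq) : photonMul indT (Aplus f)
    = cr (bigKernel fun _ _ => 1) f + cr (smallKernel fun _ _ _ => 1) f := by
  rw [Aplus_eq, photonMul_cr, ← cr_add_kernel]
  congr 1
  funext n i k
  by_cases hF : k ∈ F (n + 1)
  · by_cases hB : Big n i k
    · rw [smallKernel_of_big hB, bigKernel_of_big hB, indT_of_mem hF]
      ring
    · rw [smallKernel_of_not_big hB hF, bigKernel_of_not_big hB, indT_of_mem hF]
      ring
  · rw [smallKernel_of_notMem hF, bigKernel_of_not_big fun h => hF h.mem_F, indT_of_notMem hF]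
    ring

theorem bigWeight_Aplus_eq (f : Seq) : photonMul bigWeight (photonMul indT (Aplus f))
    = cr (bigKernel (expWeight (-(1 / 2)))) f
      + cr (smallKernel fun n _ k => bigWeight (n + 1) k) f := by
  rw [Aplus_eq, photonMul_cr, photonMul_cr, ← cr_add_kernel]
  congr 1
  funext n i k
  by_cases hF : k ∈ F (n + 1)
  · by_cases hB : Big n i k
    · rw [smallKernel_of_big hB, bigKernel_of_big hB, indT_of_mem hF, bigWeight_of_big hB,
        expWeight, neg_mul]
      ring
    · rw [smallKernel_of_not_big hB hF, bigKernel_of_not_big hB, indT_of_mem hF]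
      ring
  · rw [smallKernel_of_notMem hF, bigKernel_of_not_big fun h => hF h.mem_F, indT_of_notMem hF]
    ring

/-- A bootstrap in two steps, since the creation of small photons is not bounded without a weight
and must be subtracted before the large-photon lower bound applies. -/
theorem finiteNorm_exp_of_finiteNorm {f : Seq} (hF : ∀ n x, x.1 ∈ F n → f n x = 0)
    (hf : FiniteNorm f) (h : FiniteNorm (photonMul indT (Aplus f))) :
    FiniteNorm (photonMul (expWeight 1) f) := by
  -- Multiplying by `bigWeight` makes the small-photon part bounded on `f` itself. The lower bound
  -- with weight `e^{-p/2}` then gains `e^p`, hence `e^{p/2} f` has finite norm.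
  have h1 : FiniteNorm (photonMul (expWeight (1 / 2)) f) := by
    have h2 := (boundedMap_photonMul measurable_bigWeight abs_bigWeight_le).finiteNorm h
    rw [bigWeight_Aplus_eq] at h2
    have h3 := h2.sub (boundedMap_small_bigWeight.finiteNorm hf)
    rw [add_sub_cancel_right] at h3
    have h4 : FiniteNorm (photonMul (expWeight (-(1 / 2))) f) := by
      refine (boundedMap_photonMul (measurable_expWeight _) fun n k => ?_).finiteNorm hf
      rw [expWeight, abs_of_pos (Real.exp_pos _), neg_mul]
      exact exp_pfun_le_one (by norm_num) k
    have h5 := finiteNorm_expWeight (measurable_expWeight _) hF hf.meas h4 h3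
    rw [photonMul_photonMul] at h5
    convert h5 using 4 with n k
    rw [expWeight, expWeight, expWeight, ← Real.exp_add]
    ring_nf
  -- The decay just gained makes the unweighted small-photon part finite, so the lower bound can be
  -- applied with weight one.
  have h2 := boundedMap_small_weight.finiteNorm h1
  have h3 : cr (smallKernel weightKernel) (photonMul (expWeight (1 / 2)) f)
      = cr (smallKernel fun _ _ _ => 1) f := by
    rw [cr_photonMul]
    congr 1
    funext n i k
    by_cases hk : k ∈ F (n + 1) ∧ ¬ Big n i k
    · rw [smallKernel_of_not_big hk.2 hk.1, smallKernel_of_not_big hk.2 hk.1, weightKernel,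
        expWeight, ← Real.exp_add, neg_add_cancel, Real.exp_zero]
    · have e : ∀ u : Kernel, smallKernel u n i k = 0 := fun u =>
        Set.indicator_of_notMem (show k ∉ {k | k ∈ F (n + 1) ∧ ¬ Big n i k} from hk) _
      rw [e, e, zero_mul]
  rw [h3] at h2
  have h4 := h.sub h2
  rw [indT_Aplus_eq, add_sub_cancel_right] at h4
  have h5 : photonMul (fun _ _ => 1) f = f := by
    funext n x
    simp [photonMul]
  have h6 := finiteNorm_expWeight (fun n => measurable_const) hF hf.meas (by rwa [h5]) h4
  rwa [h5] at h6

/-- The witness is `x = e^p 1_{Tᶜ} ψ`, of finite norm by the bootstrap. -/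
theorem exists_decomp_of_mem_V (h : ψ ∈ V) : ∃ x, opP x = 0 ∧ ψ - opP ψ = opR x := by
  have h0 : FiniteNorm (photonMul (wt 0) (rep ψ)) :=
    (boundedMap_wt le_rfl).finiteNorm (rep_finiteNorm ψ)
  have hF : ∀ n (x : Config n), x.1 ∈ F n → photonMul (wt 0) (rep ψ) n x = 0 := fun n x hx => by
    simp [photonMul, wt_of_mem hx]
  have h1 : FiniteNorm (photonMul indT (Aplus (photonMul (wt 0) (rep ψ)))) := by
    rw [← oneT_eq, ← oneTc_eq]
    exact h
  have h2 := finiteNorm_exp_of_finiteNorm hF h0 h1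
  rw [photonMul_photonMul] at h2
  refine ⟨toFock _ h2, ?_, ?_⟩
  · refine eq_zero_of_rep ((rep_opP _).trans ((photonMul_congr _ (rep_toFock h2)).trans ?_))
    rw [photonMul_photonMul]
    simp only [mul_left_comm (indT _ _), indT_mul_wt, mul_zero, photonMul_zero]
    exact SeqEq.rfl'
  · refine ext_rep ((rep_sub _ _).trans ?_)
    refine SeqEq.trans (SeqEq.rfl'.sub (rep_opP ψ))
      (SeqEq.trans (SeqEq.of_eq ?_) ((rep_opR _).trans (photonMul_congr _ (rep_toFock h2))).symm)
    rw [photonMul_photonMul]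
    funext n y
    by_cases hy : y.1 ∈ F n
    · simp [photonMul, indT_of_mem hy, wt_of_mem hy]
    · simp [photonMul, indT_of_notMem hy, wt_of_notMem hy, expWeight, ← Complex.exp_add]

/-! ### Coercivity -/

theorem exists_norm_le_big : ∃ C : ℝ, 0 ≤ C ∧ ∀ x : Fock, opP x = 0 →
    ‖x‖ ≤ C * (‖boundedMap_big_wt.toCLM x‖ + ‖opR x‖) := by
  obtain ⟨C, hC⟩ := exists_lower_bound
  refine ⟨Real.sqrt C, Real.sqrt_nonneg _, fun x hx => ?_⟩
  -- The representative is changed on a null set so as to vanish on `F` pointwise, as the lower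
  -- bound requires.
  set f : Seq := photonMul (wt 0) (rep x) with hf
  have hF : ∀ n (y : Config n), y.1 ∈ F n → f n y = 0 := fun n y hy => by
    simp [hf, photonMul, wt_of_mem hy]
  have hxf : SeqEq (rep x) f := fun n => by
    have h1 := rep_opP x n
    rw [hx] at h1
    filter_upwards [h1, rep_zero n] with y hy hy'
    rw [hy'] at hy
    by_cases h : y.1 ∈ F n
    · rw [hF n y h]
      simpa [photonMul, indT_of_mem h] using hy.symm
    · simp [hf, photonMul, wt_of_notMem h]
  have h1 := hC (wt 1) (measurable_wt 1) f (photonMul_meas (measurable_wt 0) (rep_meas x)) hF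
  have h2 : photonMul (expWeight 1) (photonMul (wt 1) f) = f := by
    funext n y
    by_cases h : y.1 ∈ F n
    · simp [photonMul, hF n y h]
    · simp only [photonMul, wt_of_notMem h, expWeight, ← mul_assoc]
      rw [← Complex.ofReal_mul, ← Real.exp_add, add_neg_cancel, Real.exp_zero,
        Complex.ofReal_one, one_mul]
  rw [h2, ← sqNorm_congr hxf, ← sqNorm_congr (photonMul_congr (wt 1) hxf),
    ← sqNorm_congr (cr_congr (bigKernel (wt 1)) hxf), ← sqNorm_congr (rep_opR x),
    ← sqNorm_congr (boundedMap_big_wt.rep_toCLM x), ← enorm_sq_eq, ← enorm_sq_eq,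
    ← enorm_sq_eq] at h1
  have h3 : ‖x‖ ^ 2 ≤ C * (‖opR x‖ ^ 2 + ‖boundedMap_big_wt.toCLM x‖ ^ 2) := by
    have := ENNReal.toReal_mono (by finiteness) h1
    rw [ENNReal.toReal_mul, ENNReal.toReal_add (by finiteness) (by finiteness)] at this
    simpa using this
  refine abs_le_of_sq_le_sq' ?_ (by positivity) |>.2
  refine h3.trans ?_
  rw [mul_pow, Real.sq_sqrt C.coe_nonneg]
  refine mul_le_mul_of_nonneg_left ?_ C.coe_nonneg
  nlinarith [mul_nonneg (norm_nonneg (opR x)) (norm_nonneg (boundedMap_big_wt.toCLM x))]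

/-- Everything in `G` except creation of the large photon is a bounded operator composed with
`e^{-p/2}`. -/
theorem opG_eq (x : Fock) : opG x = boundedMap_big_wt.toCLM x +
    (boundedMap_small_weight.toCLM + opP ∘L opZ.adjoint) (opRhalf x) := by
  rw [opG_apply, add_apply, ← add_assoc]
  congr 1
  refine ext_rep ((rep_opK x).trans (SeqEq.trans (SeqEq.of_eq (cr_cutKernel _)) ?_))
  refine SeqEq.trans ?_ (rep_add _ _).symm
  exact (boundedMap_big_wt.rep_toCLM x).symm.add
    ((cr_congr _ (rep_opRhalf x).symm).trans (boundedMap_small_weight.rep_toCLM _).symm)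

/-- Interpolation between `1` and `e^{-p}`: `opRhalf` is symmetric with square `opR`, and
Cauchy–Schwarz applies. -/
theorem norm_opRhalf_sq_le (x : Fock) : ‖opRhalf x‖ ^ 2 ≤ ‖x‖ * ‖opR x‖ := by
  have h : ‖opRhalf x‖ ^ 2 = (inner ℂ x (opR x)).re := by
    rw [← opRhalf_opRhalf, ← inner_opRhalf]
    exact norm_sq_eq_re_inner (𝕜 := ℂ) _
  rw [h]
  exact (Complex.re_le_norm _).trans (norm_inner_le_norm _ _)

theorem exists_norm_le : ∃ C : ℝ, ∀ x : Fock, opP x = 0 → ‖x‖ ≤ C * (‖opG x‖ + ‖opR x‖) := by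
  obtain ⟨C, hC0, hC⟩ := exists_norm_le_big
  set L := boundedMap_small_weight.toCLM + opP ∘L opZ.adjoint with hL
  -- Young's inequality bounds the perturbation by `‖x‖/2` plus `(C‖L‖)²/2` times `‖R x‖`. Absorbing
  -- `‖x‖/2` on the left doubles the remaining constants.
  refine ⟨2 * C + (C * ‖L‖) ^ 2, fun x hx => ?_⟩
  have h1 := hC x hx
  have h2 : ‖boundedMap_big_wt.toCLM x‖ ≤ ‖opG x‖ + ‖L‖ * ‖opRhalf x‖ := by
    have e : boundedMap_big_wt.toCLM x = opG x - L (opRhalf x) := by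
      rw [opG_eq]; abel
    rw [e]
    exact (norm_sub_le _ _).trans (add_le_add le_rfl (L.le_opNorm _))
  have h3 : C * ‖L‖ * ‖opRhalf x‖ ≤ (‖x‖ + (C * ‖L‖) ^ 2 * ‖opR x‖) / 2 := by
    refine abs_le_of_sq_le_sq' ?_ (by positivity) |>.2
    have h4 := mul_le_mul_of_nonneg_left (norm_opRhalf_sq_le x) (sq_nonneg (C * ‖L‖))
    nlinarith [sq_nonneg (‖x‖ - (C * ‖L‖) ^ 2 * ‖opR x‖)]
  have h5 := mul_le_mul_of_nonneg_left h2 hC0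
  have h6 := norm_nonneg (opG x)
  have h7 := mul_nonneg (sq_nonneg (C * ‖L‖)) h6
  nlinarith

/-! ### The operator in block form -/

theorem rep_HI (ψ : HI.domain) : SeqEq (rep (HI ψ)) (A (rep (ψ : Fock))) :=
  rep_toFock ψ.2.2.2

theorem opP_HI {ψ : HI.domain} {x : Fock} (h : (ψ : Fock) - opP ψ = opR x) :
    opP (HI ψ) = opG x ∧ opR (HI ψ) = opG.adjoint ψ + opN x := by
  constructor
  · refine ext_rep ((rep_opP _).trans ((photonMul_congr _ (rep_HI ψ)).trans ?_))
    rw [← oneT_eq]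
    exact oneT_A_of_decomp h
  · exact ext_rep ((rep_opR _).trans ((photonMul_congr _ (rep_HI ψ)).trans (wt_A_of_decomp h)))

/-- The first equation determines `A ψ` on `T` and the second off `T`, where the positive weight
`e^{-p}` cancels. So `A ψ = η` almost everywhere, which gives the finite norm; the decomposition
supplies absolute convergence and membership in `V`. -/
theorem mem_domain_HI {ψ η x : Fock} (h : ψ - opP ψ = opR x) (h1 : opP η = opG x)
    (h2 : opR η = opG.adjoint ψ + opN x) : ∃ h : ψ ∈ HI.domain, HI ⟨ψ, h⟩ = η := by
  have e1 := (oneT_A_of_decomp h).trans ((SeqEq.of_eq (congrArg rep h1.symm)).trans (rep_opP η))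
  have e2 := (wt_A_of_decomp h).trans ((SeqEq.of_eq (congrArg rep h2.symm)).trans (rep_opR η))
  have e : SeqEq (A (rep ψ)) (rep η) := fun n => by
    filter_upwards [e1 n, e2 n] with y hy1 hy2
    by_cases hy : y.1 ∈ F n
    · simpa [oneT, photonMul, hy, indT_of_mem hy] using hy1
    · have hne : ((wt 1 n y.1 : ℝ) : ℂ) ≠ 0 := by
        rw [wt_of_notMem hy]
        exact_mod_cast (Real.exp_pos _).ne'
      exact mul_left_cancel₀ hne hy2
  have hmem : ψ ∈ HI.domain :=
    ⟨mem_V_of_decomp h, absConv_of_decomp h, (rep_finiteNorm η).congr e.symm⟩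
  exact ⟨hmem, ext_rep ((rep_HI ⟨ψ, hmem⟩).trans e)⟩

end SimplifiedDirac

end

theorem proposition1 :
    Dense (SimplifiedDirac.HI.domain : Set SimplifiedDirac.Fock) ∧
      IsSelfAdjoint SimplifiedDirac.HI := by
  obtain ⟨C, hC⟩ := SimplifiedDirac.exists_norm_le
  exact SimplifiedDirac.dense_and_isSelfAdjoint_of_block SimplifiedDirac.HI
    SimplifiedDirac.inner_opP SimplifiedDirac.opP_opP SimplifiedDirac.inner_opR
    SimplifiedDirac.opP_opR SimplifiedDirac.inner_opN SimplifiedDirac.opP_opN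
    SimplifiedDirac.opG_opP SimplifiedDirac.opP_opG hC
    (fun ψ => SimplifiedDirac.exists_decomp_of_mem_V ψ.2.1)
    (fun _ _ _ h => SimplifiedDirac.opP_HI h)
    (fun _ _ _ _ h h1 h2 => SimplifiedDirac.mem_domain_HI h h1 h2)
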